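/- Let $M$ be a smooth $n$-manifold, $n\ge 3$, with a conformal structure of signature $(p,q)$, $p+q=n$ (a class of pseudo-Riemannian metrics modulo multiplication by positive smooth functions). Let $\pi:\mathcal Q\to M$ be the ray bundle in $S^2T^*M$ whose fibre over $x$ consists of the values $g_x$ of the metrics in the class, with the action $\rho^s(g_x)=s^2g_x$ of $\mathbb R_+$. Let $\tilde M$ be an ambient manifold: a smooth $(n+2)$-manifold with a smooth free $\mathbb R_+$-action and an $\mathbb R_+$-equivariant smooth embedding $\iota:\mathcal Q\to\tilde M$ (suppressed below). Let $X$ be the infinitesimal generator of the action, $X(x)=\frac{d}{dt}|_{t=0}\rho^{e^t}(x)$. Let $\tilde h$ be an ambient metric: a pseudo-Riemannian metric of signature $(p+1,q+1)$ on $\tilde M$ with $\mathcal L_X\tilde h=2\tilde h$ and $\tilde h(\xi,\eta)=g_x(T\pi\,\xi,T\pi\,\eta)$ for $u=g_x\in\mathcal Q$ and $\xi,\eta\in T_u\mathcal Q$. Let $\tilde\nabla$ be its Levi-Civita connection, $\tilde R(\xi,\eta)=[\tilde\nabla_\xi,\tilde\nabla_\eta]-\tilde\nabla_{[\xi,\eta]}$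 its curvature and $\alpha=\tilde h(X,\cdot)$, with $d\alpha(\xi,\eta)=\xi\cdot\alpha(\eta)-\eta\cdot\alpha(\xi)-\alpha([\xi,\eta])$ and $(\tilde\nabla d\alpha)(\zeta,\xi,\eta)=(\tilde\nabla_\zeta d\alpha)(\xi,\eta)$. A tensor field (in particular a function) $t$ on $\tilde M$ is $O(r^\ell)$ if $\mathcal L_{\xi_k}\cdots\mathcal L_{\xi_1}t$ vanishes along $\mathcal Q$ for all $0\le k<\ell$ and all smooth vector fields $\xi_1,\dots,\xi_k$ on $\tilde M$ (no condition for $\ell=0$). The tangential components of a $2$-form $t$ vanish to order $\ell$ along $\mathcal Q$ if, for all smooth vector fields $\eta_1,\eta_2$ on $\tilde M$ whose restrictions to $\mathcal Q$ are tangent to $\mathcal Q$, the function $t(\eta_1,\eta_2)$ is $O(r^\ell)$. Proposition 2.5. For all smooth vector fields $\xi,\eta,\zeta$ on $\tilde M$, $$\tilde h(\tilde R(\xi,\eta)X,\zeta)=-\tilde h(\tilde R(\xi,\eta)\zeta,X)=\tilde h(\tilde R(X,\zeta)\xi,\eta)=-\tfrac12(\tilde\nabla d\alpha)(\zeta,\xi,\eta).$$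 If moreover $d\alpha=O(r^\ell)$ for some $\ell\ge1$, then this function is $O(r^{\ell-1})$ for all $\xi,\eta,\zeta$, and it is $O(r^\ell)$ if the restriction to $\mathcal Q$ of $\zeta$, or the restrictions to $\mathcal Q$ of both $\xi$ and $\eta$, are tangent to $\mathcal Q$. Consequently, if $d\alpha=O(r^\ell)$ with $\ell\ge1$, the tangential components of $d\alpha$ vanish to order $\ell+1$ along $\mathcal Q$. -/

import Mathlib

open Manifold Bundle VectorField Set
open scoped ContDiff Topology

noncomputable section

/-! ## Pseudo-Riemannian metrics -/

/-- A vector field on `N` (no regularity); `SmoothField ξ` says that it is smooth. -/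
abbrev VecField (m : ℕ) (N : Type*) [TopologicalSpace N] [ChartedSpace (EuclideanSpace ℝ (Fin m)) N] :=
  Π x : N, TangentSpace (𝓡 m) x

/-- A field of bilinear forms on the tangent spaces of `N` (no regularity). -/
abbrev BilinField (m : ℕ) (N : Type*) [TopologicalSpace N]
    [ChartedSpace (EuclideanSpace ℝ (Fin m)) N] :=
  Π x : N, TangentSpace (𝓡 m) x →L[ℝ] TangentSpace (𝓡 m) x →L[ℝ] ℝ

/-- `ξ` is a smooth vector field on `N`, i.e. `ξ ∈ 𝔛(N)`. -/
def SmoothField {m : ℕ} {N : Type*} [TopologicalSpace N]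
    [ChartedSpace (EuclideanSpace ℝ (Fin m)) N] [IsManifold (𝓡 m) ∞ N] (ξ : VecField m N) : Prop :=
  ContMDiff (𝓡 m) (𝓡 m).tangent ∞ (fun x => (⟨x, ξ x⟩ : TangentBundle (𝓡 m) N))

/-- A bilinear form is symmetric and nondegenerate of signature `(p, q)`: it is
`diag(1, …, 1, -1, …, -1)` (`p` times `1`, `q` times `-1`) in some basis. -/
def HasSignature {V : Type*} [AddCommGroup V] [Module ℝ V] (p q : ℕ) (B : V → V → ℝ) : Prop :=
  ∃ b : Module.Basis (Fin p ⊕ Fin q) ℝ V, ∀ i j,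
    B (b i) (b j) = if i = j then Sum.elim (fun _ => 1) (fun _ => -1) i else 0

/-- `g` is a smooth pseudo-Riemannian metric of signature `(p, q)`. -/
structure IsPseudoRiemannian {m : ℕ} {N : Type*} [TopologicalSpace N]
    [ChartedSpace (EuclideanSpace ℝ (Fin m)) N] [IsManifold (𝓡 m) ∞ N]
    (p q : ℕ) (g : BilinField m N) : Prop where
  smooth : ContMDiff (𝓡 m) ((𝓡 m).prod
      𝓘(ℝ, EuclideanSpace ℝ (Fin m) →L[ℝ] EuclideanSpace ℝ (Fin m) →L[ℝ] ℝ)) ∞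
    (fun x => TotalSpace.mk' (EuclideanSpace ℝ (Fin m) →L[ℝ] EuclideanSpace ℝ (Fin m) →L[ℝ] ℝ)
      (E := fun x : N => TangentSpace (𝓡 m) x →L[ℝ] TangentSpace (𝓡 m) x →L[ℝ] ℝ) x (g x))
  signature : ∀ x, HasSignature p q (fun v w => g x v w)

/-! ## Conformal structures and the bundle of metrics -/

/-- A conformal structure of signature `(p, q)` on an `n`-manifold `M`, `n ≥ 3`: an equivalence
class of pseudo-Riemannian metrics modulo multiplication by positive smooth functions. -/
structure ConformalStructure (n p q : ℕ) (M : Type*) [TopologicalSpace M]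
    [ChartedSpace (EuclideanSpace ℝ (Fin n)) M] [IsManifold (𝓡 n) ∞ M] where
  three_le : 3 ≤ n
  metrics : Set (BilinField n M)
  nonempty : metrics.Nonempty
  isPseudoRiemannian : ∀ g ∈ metrics, IsPseudoRiemannian p q g
  mem_iff : ∀ g ∈ metrics, ∀ g' : BilinField n M, g' ∈ metrics ↔
    ∃ f : M → ℝ, ContMDiff (𝓡 n) 𝓘(ℝ, ℝ) ∞ f ∧ (∀ x, 0 < f x) ∧ g' = fun x => f x • g x

namespace ConformalStructure

variable {n p q : ℕ} {M : Type*} [TopologicalSpace M]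
    [ChartedSpace (EuclideanSpace ℝ (Fin n)) M] [IsManifold (𝓡 n) ∞ M]

/-- The ray bundle `𝒬 ⊂ S²T*M` of a conformal structure: its points over `x` are the values `g_x`
of the metrics `g` in the conformal class. -/
@[ext]
structure RayBundle (c : ConformalStructure n p q M) where
  proj : M
  form : TangentSpace (𝓡 n) proj →L[ℝ] TangentSpace (𝓡 n) proj →L[ℝ] ℝ
  mem : ∃ g ∈ c.metrics, form = g proj

/-- Constant positive multiples of a metric of the class belong to the class. -/
theorem smul_mem (c : ConformalStructure n p q M) {g : BilinField n M} (hg : g ∈ c.metrics)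
    {a : ℝ} (ha : 0 < a) : (fun x => a • g x) ∈ c.metrics :=
  (c.mem_iff g hg _).2 ⟨fun _ => a, contMDiff_const, fun _ => ha, rfl⟩

/-- The principal action `ρ^s(g_x) = s² g_x` of `ℝ₊` on `𝒬`. -/
instance (c : ConformalStructure n p q M) : SMul {s : ℝ // 0 < s} c.RayBundle where
  smul s u := ⟨u.proj, (s : ℝ) ^ 2 • u.form, by
    obtain ⟨g, hg, hu⟩ := u.mem
    exact ⟨_, c.smul_mem hg (pow_pos s.2 2), by rw [hu]⟩⟩

/-- A metric `g` of the class trivialises `𝒬`: `(x, t) ↦ ρ^{exp t}(g_x) = e^{2t} g_x`. -/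
def param (c : ConformalStructure n p q M) (g : BilinField n M) (hg : g ∈ c.metrics)
    (z : M × ℝ) : c.RayBundle :=
  ⟨z.1, Real.exp z.2 ^ 2 • g z.1, _, c.smul_mem hg (pow_pos (Real.exp_pos z.2) 2), rfl⟩

theorem exists_form_ne_zero (c : ConformalStructure n p q M) {g : BilinField n M}
    (hg : g ∈ c.metrics) (x : M) : ∃ v w, g x v w ≠ 0 := by
  obtain ⟨b, hb⟩ := (c.isPseudoRiemannian g hg).signature x
  have hcard : n = Fintype.card (Fin p ⊕ Fin q) := by
    have h1 := Module.finrank_eq_card_basis b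
    have h2 : Module.finrank ℝ (TangentSpace (𝓡 n) x) = n :=
      finrank_euclideanSpace_fin (𝕜 := ℝ) (n := n)
    omega
  have : 0 < Fintype.card (Fin p ⊕ Fin q) := by have := c.three_le; omega
  obtain ⟨i⟩ := Fintype.card_pos_iff.1 this
  refine ⟨b i, b i, ?_⟩
  have h := hb i i
  simp only [if_true] at h
  rw [h]
  rcases i with i | i <;> simp

theorem param_bijective (c : ConformalStructure n p q M) (g : BilinField n M)
    (hg : g ∈ c.metrics) : Function.Bijective (c.param g hg) := by
  constructor
  · rintro ⟨x, t⟩ ⟨y, s⟩ h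
    have hxy : x = y := congrArg RayBundle.proj h
    subst hxy
    have h2 : Real.exp t ^ 2 • g x = Real.exp s ^ 2 • g x := by
      simpa [param] using h
    obtain ⟨v, w, hvw⟩ := c.exists_form_ne_zero hg x
    have h3 : Real.exp t ^ 2 = Real.exp s ^ 2 := by
      have h5 : Real.exp t ^ 2 * g x v w = Real.exp s ^ 2 * g x v w :=
        congrArg (fun b => b v w) h2
      exact mul_right_cancel₀ hvw h5
    have h4 := (pow_left_inj₀ (Real.exp_pos t).le (Real.exp_pos s).le two_ne_zero).1 h3
    rw [Real.exp_injective h4]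
  · rintro ⟨x, b, g', hg', rfl⟩
    obtain ⟨f, -, hf, rfl⟩ := (c.mem_iff g hg g').1 hg'
    refine ⟨(x, Real.log (f x) / 2), ?_⟩
    have : Real.exp (Real.log (f x) / 2) ^ 2 = f x := by
      rw [← Real.exp_nat_mul]
      rw [show ((2 : ℕ) : ℝ) * (Real.log (f x) / 2) = Real.log (f x) by push_cast; ring,
        Real.exp_log (hf x)]
    simp [param, this]

/-- The global trivialisation `𝒬 ≃ M × ℝ` given by a metric of the class. -/
def trivEquiv (c : ConformalStructure n p q M) : c.RayBundle ≃ M × ℝ :=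
  (Equiv.ofBijective _ (c.param_bijective c.nonempty.some c.nonempty.some_mem)).symm

/-- The topology of `𝒬` as a ray subbundle of `S²T*M`: the one carried over by a trivialisation
(every metric of the class gives the same one, see `exists_diffeomorph` below). -/
instance (c : ConformalStructure n p q M) : TopologicalSpace c.RayBundle :=
  TopologicalSpace.induced c.trivEquiv inferInstance

def trivHomeo (c : ConformalStructure n p q M) : c.RayBundle ≃ₜ M × ℝ :=
  c.trivEquiv.toHomeomorphOfIsInducing ⟨rfl⟩

/-- The model with corners of `𝒬`, a manifold of dimension `n + 1` without boundary. -/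
abbrev rayModel (n : ℕ) := (𝓡 n).prod 𝓘(ℝ, ℝ)

/-- The smooth structure of `𝒬` as a ray subbundle of `S²T*M`: the one carried over by a
trivialisation (every metric of the class gives the same one, see `exists_diffeomorph` below). -/
instance (c : ConformalStructure n p q M) :
    ChartedSpace (ModelProd (EuclideanSpace ℝ (Fin n)) ℝ) c.RayBundle where
  atlas := {e | ∃ e' ∈ atlas (ModelProd (EuclideanSpace ℝ (Fin n)) ℝ) (M × ℝ),
    e = c.trivHomeo.toOpenPartialHomeomorph.trans e'}
  chartAt u := c.trivHomeo.toOpenPartialHomeomorph.trans (chartAt _ (c.trivHomeo u))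
  mem_chart_source u := by simp
  chart_mem_atlas u := ⟨_, chart_mem_atlas _ _, rfl⟩

instance (c : ConformalStructure n p q M) : IsManifold (rayModel n) ∞ c.RayBundle where
  compatible := by
    rintro _ _ ⟨e, he, rfl⟩ ⟨e', he', rfl⟩
    have key : (c.trivHomeo.toOpenPartialHomeomorph.trans e).symm.trans
        (c.trivHomeo.toOpenPartialHomeomorph.trans e') = e.symm.trans e' := by
      ext x <;> simp
    rw [key]
    exact HasGroupoid.compatible (G := contDiffGroupoid ∞ (rayModel n)) he he'

theorem contMDiff_trivHomeo (c : ConformalStructure n p q M) :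
    ContMDiff (rayModel n) (rayModel n) ∞ c.trivHomeo := by
  intro u
  rw [contMDiffAt_iff]
  refine ⟨c.trivHomeo.continuous.continuousAt, ?_⟩
  have h := (contMDiffAt_iff.1 (contMDiffAt_id (I := rayModel n) (n := ∞)
    (x := c.trivHomeo u))).2
  have e : (extChartAt (rayModel n) (c.trivHomeo u) ∘ c.trivHomeo ∘
      (extChartAt (rayModel n) u).symm) = (extChartAt (rayModel n) (c.trivHomeo u) ∘ id ∘
      (extChartAt (rayModel n) (c.trivHomeo u)).symm) := by
    funext z
    exact congrArg (extChartAt (rayModel n) (c.trivHomeo u))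
      (c.trivHomeo.apply_symm_apply ((extChartAt (rayModel n) (c.trivHomeo u)).symm z))
  rw [e]
  exact h

theorem contMDiff_trivHomeo_symm (c : ConformalStructure n p q M) :
    ContMDiff (rayModel n) (rayModel n) ∞ c.trivHomeo.symm := by
  intro z
  obtain ⟨u, rfl⟩ := c.trivHomeo.surjective z
  rw [contMDiffAt_iff]
  refine ⟨c.trivHomeo.symm.continuous.continuousAt, ?_⟩
  have h := (contMDiffAt_iff.1 (contMDiffAt_id (I := rayModel n) (n := ∞)
    (x := c.trivHomeo u))).2
  rw [c.trivHomeo.symm_apply_apply]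
  have e : (extChartAt (rayModel n) u ∘ c.trivHomeo.symm ∘
      (extChartAt (rayModel n) (c.trivHomeo u)).symm) =
      (extChartAt (rayModel n) (c.trivHomeo u) ∘ id ∘
      (extChartAt (rayModel n) (c.trivHomeo u)).symm) := by
    funext z
    exact congrArg (extChartAt (rayModel n) (c.trivHomeo u))
      (c.trivHomeo.apply_symm_apply ((extChartAt (rayModel n) (c.trivHomeo u)).symm z))
  rw [e]
  exact h

/-- Any metric of the class defines a diffeomorphism `M × ℝ ≅ 𝒬`: the smooth structure of `𝒬`
depends on the conformal structure only. -/
theorem exists_diffeomorph (c : ConformalStructure n p q M) (g : BilinField n M)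
    (hg : g ∈ c.metrics) :
    ∃ Φ : Diffeomorph (rayModel n) (rayModel n) (M × ℝ) c.RayBundle ∞, ⇑Φ = c.param g hg := by
  obtain ⟨f, hf, hpos, hgf⟩ := (c.mem_iff _ c.nonempty.some_mem g).1 hg
  have hlog : ContMDiff (𝓡 n) 𝓘(ℝ, ℝ) ∞ (fun x => Real.log (f x) / 2) := by
    intro x
    have : ContDiffAt ℝ ∞ (fun y : ℝ => Real.log y / 2) (f x) :=
      (Real.contDiffAt_log.2 (hpos x).ne').div_const 2
    exact ContMDiffAt.comp x this.contMDiffAt (hf x)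
  have hexp : ∀ x t, Real.exp (t + Real.log (f x) / 2) ^ 2 = Real.exp t ^ 2 * f x := by
    intro x t
    rw [Real.exp_add, mul_pow]
    congr 1
    rw [← Real.exp_nat_mul,
      show ((2 : ℕ) : ℝ) * (Real.log (f x) / 2) = Real.log (f x) by push_cast; ring,
      Real.exp_log (hpos x)]
  have hpar : ∀ z : M × ℝ, c.param g hg z =
      c.trivHomeo.symm (z.1, z.2 + Real.log (f z.1) / 2) := by
    rintro ⟨x, t⟩
    subst hgf
    change _ = c.param _ c.nonempty.some_mem (x, t + Real.log (f x) / 2)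
    simp only [param, hexp]
    congr 1
    ext v w
    exact (mul_assoc _ _ _).symm
  let τ : M × ℝ ≃ M × ℝ :=
    { toFun := fun z => (z.1, z.2 + Real.log (f z.1) / 2)
      invFun := fun z => (z.1, z.2 - Real.log (f z.1) / 2)
      left_inv := fun z => by simp
      right_inv := fun z => by simp }
  refine ⟨⟨τ.trans c.trivHomeo.symm.toEquiv, ?_, ?_⟩, ?_⟩
  · refine c.contMDiff_trivHomeo_symm.comp ?_
    exact contMDiff_fst.prodMk (contMDiff_snd.add (hlog.comp contMDiff_fst))
  · have h1 : ContMDiff (rayModel n) (rayModel n) ∞ τ.symm :=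
      contMDiff_fst.prodMk (contMDiff_snd.sub (hlog.comp contMDiff_fst))
    exact h1.comp c.contMDiff_trivHomeo
  · funext z
    exact (hpar z).symm

end ConformalStructure

/-! ## Calculus on a manifold -/

section Calculus

variable {m : ℕ} {N : Type*} [TopologicalSpace N] [ChartedSpace (EuclideanSpace ℝ (Fin m)) N]
    [IsManifold (𝓡 m) ∞ N]

/-- The directional derivative `ξ · f` of a function along a vector field. -/
def dirDeriv (ξ : VecField m N) (f : N → ℝ) : N → ℝ := fun x => mvfderiv (𝓡 m) f x (ξ x)

/-- The Lie bracket `[ξ, η]`. -/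
abbrev lieBr (ξ η : VecField m N) : VecField m N := mlieBracket (𝓡 m) ξ η

/-- The Lie derivative of a covariant `2`-tensor field `t`, where `t` is given by its values
`t(η, ζ)` on vector fields:
`(ℒ_ξ t)(η, ζ) = ξ · t(η, ζ) - t([ξ, η], ζ) - t(η, [ξ, ζ])`. -/
def lieDerivTwo (ξ : VecField m N) (t : VecField m N → VecField m N → N → ℝ) :
    VecField m N → VecField m N → N → ℝ :=
  fun η ζ x => dirDeriv ξ (t η ζ) x - t (lieBr ξ η) ζ x - t η (lieBr ξ ζ) x

/-- The function `h(ξ, η)`. -/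
def pairing (h : BilinField m N) (ξ η : VecField m N) : N → ℝ := fun x => h x (ξ x) (η x)

theorem pairing_apply {m : ℕ} {N : Type*} [TopologicalSpace N]
    [ChartedSpace (EuclideanSpace ℝ (Fin m)) N] (h : BilinField m N) (ξ η : VecField m N) (x : N) :
    pairing h ξ η x = h x (ξ x) (η x) := rfl

/-- The exterior derivative of a one-form:
`dα(ξ, η) = ξ · α(η) - η · α(ξ) - α([ξ, η])`. -/
def extDerivOne (α : Π x : N, TangentSpace (𝓡 m) x →L[ℝ] ℝ) (ξ η : VecField m N) : N → ℝ :=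
  fun x => dirDeriv ξ (fun y => α y (η y)) x - dirDeriv η (fun y => α y (ξ y)) x
    - α x (lieBr ξ η x)

/-- The right hand side of the Koszul formula. -/
def koszul (h : BilinField m N) (ξ η ζ : VecField m N) : N → ℝ := fun x =>
  dirDeriv ξ (pairing h η ζ) x + dirDeriv η (pairing h ξ ζ) x - dirDeriv ζ (pairing h ξ η) x
    + pairing h (lieBr ξ η) ζ x - pairing h (lieBr ξ ζ) η x - pairing h (lieBr η ζ) ξ x

/-- The Levi-Civita connection `∇_ξ η` of a pseudo-Riemannian metric `h`: the vector field
characterised by the Koszul formula `2 h(∇_ξ η, ζ) = koszul h ξ η ζ` for all `ζ ∈ 𝔛(N)`. -/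
def leviCivita (h : BilinField m N) (ξ η : VecField m N) : VecField m N := fun x =>
  Classical.epsilon fun v : TangentSpace (𝓡 m) x =>
    ∀ ζ : VecField m N, SmoothField ζ → 2 * h x v (ζ x) = koszul h ξ η ζ x

/-- The Riemann curvature `R(ξ, η)ζ = ∇_ξ ∇_η ζ - ∇_η ∇_ξ ζ - ∇_{[ξ, η]} ζ` of `h`. -/
def riemann (h : BilinField m N) (ξ η ζ : VecField m N) : VecField m N := fun x =>
  leviCivita h ξ (leviCivita h η ζ) x - leviCivita h η (leviCivita h ξ ζ) x
    - leviCivita h (lieBr ξ η) ζ x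

/-- The covariant derivative of a covariant `2`-tensor field for the Levi-Civita connection of `h`:
`(∇t)(ζ, ξ, η) = ζ · t(ξ, η) - t(∇_ζ ξ, η) - t(ξ, ∇_ζ η)`. -/
def covDerivTwo (h : BilinField m N) (t : VecField m N → VecField m N → N → ℝ)
    (ζ ξ η : VecField m N) : N → ℝ := fun x =>
  dirDeriv ζ (t ξ η) x - t (leviCivita h ζ ξ) η x - t ξ (leviCivita h ζ η) x

theorem HasSignature.symm' {V : Type*} [AddCommGroup V] [Module ℝ V] {p q : ℕ}
    {B : V →ₗ[ℝ] V →ₗ[ℝ] ℝ} (hB : HasSignature p q (fun v w => B v w)) (v w : V) :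
    B v w = B w v := by
  obtain ⟨b, hb⟩ := hB
  have : B = B.flip := b.ext fun i => b.ext fun j => by
    have h1 := hb i j
    have h2 := hb j i
    simp only at h1 h2
    rw [LinearMap.flip_apply, h1, h2]
    by_cases hij : i = j
    · subst hij; rfl
    · rw [if_neg hij, if_neg (Ne.symm hij)]
  conv_lhs => rw [this]
  rfl

theorem HasSignature.exists_dual {V : Type*} [AddCommGroup V] [Module ℝ V] {p q : ℕ}
    {B : V →ₗ[ℝ] V →ₗ[ℝ] ℝ} (hB : HasSignature p q (fun v w => B v w)) (φ : V →ₗ[ℝ] ℝ) :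
    ∃ v, ∀ w, B v w = φ w := by
  obtain ⟨b, hb⟩ := hB
  refine ⟨∑ i, (φ (b i) * Sum.elim (fun _ => (1 : ℝ)) (fun _ => -1) i) • b i, ?_⟩
  intro w
  have : B (∑ i, (φ (b i) * Sum.elim (fun _ => (1 : ℝ)) (fun _ => -1) i) • b i) = φ := by
    refine b.ext fun j => ?_
    have hb' : ∀ i, B (b i) (b j) = if i = j then Sum.elim (fun _ => 1) (fun _ => -1) i else 0 :=
      fun i => hb i j
    simp only [map_sum, map_smul, LinearMap.sum_apply, LinearMap.smul_apply, hb', smul_eq_mul,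
      mul_ite, mul_zero, Finset.sum_ite_eq', Finset.mem_univ, if_true]
    rcases j with j | j <;> simp
  rw [this]

theorem mdifferentiableAt_pairing {p q : ℕ} {h : BilinField m N} (hh : IsPseudoRiemannian p q h)
    {x : N} {η ζ : VecField m N}
    (hη : MDifferentiableAt (𝓡 m) (𝓡 m).tangent (fun y => (⟨y, η y⟩ : TangentBundle (𝓡 m) N)) x)
    (hζ : MDifferentiableAt (𝓡 m) (𝓡 m).tangent (fun y => (⟨y, ζ y⟩ : TangentBundle (𝓡 m) N)) x) :
    MDifferentiableAt (𝓡 m) 𝓘(ℝ, ℝ) (pairing h η ζ) x := by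
  have : MDifferentiableAt (𝓡 m) ((𝓡 m).prod 𝓘(ℝ)) (fun y =>
      TotalSpace.mk' ℝ (E := Bundle.Trivial N ℝ) y (h y (η y) (ζ y))) x :=
    MDifferentiableAt.clm_bundle_apply₂ (F₁ := EuclideanSpace ℝ (Fin m))
      (F₂ := EuclideanSpace ℝ (Fin m)) ((hh.smooth x).mdifferentiableAt (by simp)) hη hζ
  rw [mdifferentiableAt_totalSpace] at this
  exact this.2

/-- The Koszul expression is tensorial in its last argument. -/
theorem tensorialAt_koszul {p q : ℕ} {h : BilinField m N} (hh : IsPseudoRiemannian p q h)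
    {x : N} {ξ η : VecField m N} (hξ : SmoothField ξ) (hη : SmoothField η) :
    TensorialAt (𝓡 m) (EuclideanSpace ℝ (Fin m))
      (fun ζ : VecField m N => koszul h ξ η ζ x) x := by
  have hξ' := (hξ x).mdifferentiableAt (by simp)
  have hη' := (hη x).mdifferentiableAt (by simp)
  have hsymm : ∀ v w, h x v w = h x w v := fun v w =>
    HasSignature.symm' (B := (ContinuousLinearMap.coeLM ℝ).comp (h x).toLinearMap)
      (hh.signature x) v w
  constructor
  · intro f ζ hf hζ
    have e : ∀ θ, pairing h θ (f • ζ) = f * pairing h θ ζ := by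
      intro θ; funext y; simp [pairing]
    simp only [koszul, e, dirDeriv, lieBr]
    rw [mvfderiv_mul hf (mdifferentiableAt_pairing hh hη' hζ),
      mvfderiv_mul hf (mdifferentiableAt_pairing hh hξ' hζ)]
    simp only [pairing, mlieBracket_smul_right hf hζ]
    have h1 := hsymm (ζ x) (η x)
    have h2 := hsymm (ζ x) (ξ x)
    simp only [add_apply, smul_apply, map_add, map_smul, Pi.smul_apply', Pi.mul_apply,
      smul_eq_mul, pairing_apply, h1, h2]
    ring
  · intro ζ ζ' hζ hζ'
    have e : ∀ θ, pairing h θ (ζ + ζ') = pairing h θ ζ + pairing h θ ζ' := by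
      intro θ; funext y; simp [pairing]
    simp only [koszul, e, dirDeriv, lieBr]
    rw [mvfderiv_add (mdifferentiableAt_pairing hh hη' hζ)
        (mdifferentiableAt_pairing hh hη' hζ'),
      mvfderiv_add (mdifferentiableAt_pairing hh hξ' hζ)
        (mdifferentiableAt_pairing hh hξ' hζ')]
    simp only [pairing, mlieBracket_add_right hζ hζ']
    simp only [map_add, Pi.add_apply, add_apply, pairing_apply]
    ring

/-- The Levi-Civita connection exists: `∇_ξ η` satisfies the Koszul formula. -/
theorem leviCivita_spec {p q : ℕ} {h : BilinField m N} (hh : IsPseudoRiemannian p q h)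
    {ξ η ζ : VecField m N} (hξ : SmoothField ξ) (hη : SmoothField η) (hζ : SmoothField ζ) (x : N) :
    2 * h x (leviCivita h ξ η x) (ζ x) = koszul h ξ η ζ x := by
  have hT := tensorialAt_koszul hh (x := x) hξ hη
  obtain ⟨v, hv⟩ := HasSignature.exists_dual
    (B := (ContinuousLinearMap.coeLM ℝ).comp (h x).toLinearMap) (hh.signature x)
    ((1 / 2 : ℝ) • (TensorialAt.mkHom _ x hT).toLinearMap)
  have hex : ∃ v : TangentSpace (𝓡 m) x,
      ∀ ζ : VecField m N, SmoothField ζ → 2 * h x v (ζ x) = koszul h ξ η ζ x := by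
    refine ⟨v, fun ζ hζ => ?_⟩
    have h1 := hv (ζ x)
    have h2 := TensorialAt.mkHom_apply hT ((hζ x).mdifferentiableAt (by simp))
    have h3 : h x v (ζ x) = 1 / 2 * koszul h ξ η ζ x := by
      rw [← h2]; exact h1
    rw [h3]; ring
  exact Classical.epsilon_spec hex ζ hζ

end Calculus

/-! ## Orders of vanishing along a subset -/

section Vanishing

/-- A function `f` is `O(r^ℓ)` along `Q`: for all `k < ℓ` and `ξ₁, …, ξ_k ∈ 𝔛(N)`, the function
`ξ_k ⋯ ξ₁ · f` vanishes on `Q`. (No condition for `ℓ = 0`.) -/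
def VanishesToOrder (m : ℕ) {N : Type*} [TopologicalSpace N]
    [ChartedSpace (EuclideanSpace ℝ (Fin m)) N] [IsManifold (𝓡 m) ∞ N]
    (Q : Set N) (ℓ : ℕ) (f : N → ℝ) : Prop :=
  ∀ L : List (VecField m N), L.length < ℓ → (∀ ξ ∈ L, SmoothField ξ) →
    ∀ u ∈ Q, L.foldr dirDeriv f u = 0

variable {m : ℕ} {N : Type*} [TopologicalSpace N] [ChartedSpace (EuclideanSpace ℝ (Fin m)) N]
    [IsManifold (𝓡 m) ∞ N]

/-- A covariant `2`-tensor field `t` is `O(r^ℓ)` along `Q`: for all `k < ℓ` and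
`ξ₁, …, ξ_k ∈ 𝔛(N)`, the iterated Lie derivative `ℒ_{ξ_k} ⋯ ℒ_{ξ₁} t` vanishes on `Q`. -/
def TensorVanishesToOrder (Q : Set N) (ℓ : ℕ) (t : VecField m N → VecField m N → N → ℝ) : Prop :=
  ∀ L : List (VecField m N), L.length < ℓ → (∀ ξ ∈ L, SmoothField ξ) →
    ∀ η ζ : VecField m N, SmoothField η → SmoothField ζ →
      ∀ u ∈ Q, L.foldr lieDerivTwo t η ζ u = 0

end Vanishing

/-! ## Ambient manifolds and ambient metrics -/

section Ambient

variable {n p q : ℕ} {M : Type*} [TopologicalSpace M] [ChartedSpace (EuclideanSpace ℝ (Fin n)) M]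
    [IsManifold (𝓡 n) ∞ M]

/-- `N` is an ambient manifold for the conformal structure `c`: an `(n + 2)`-manifold with a smooth
free action of `ℝ₊` and an equivariant smooth embedding `ι : 𝒬 → N`. Smoothness of the action is
expressed through the diffeomorphism `exp : ℝ → ℝ₊`. -/
structure AmbientManifold (c : ConformalStructure n p q M) (N : Type*) [TopologicalSpace N]
    [ChartedSpace (EuclideanSpace ℝ (Fin (n + 2))) N] [IsManifold (𝓡 (n + 2)) ∞ N]
    [MulAction {s : ℝ // 0 < s} N] where
  smooth_action : ContMDiff (𝓘(ℝ, ℝ).prod (𝓡 (n + 2))) (𝓡 (n + 2)) ∞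
    (fun z : ℝ × N => (⟨Real.exp z.1, Real.exp_pos z.1⟩ : {s : ℝ // 0 < s}) • z.2)
  free : ∀ (s : {s : ℝ // 0 < s}) (x : N), s • x = x → s = 1
  ι : c.RayBundle → N
  isSmoothEmbedding :
    IsSmoothEmbedding (ConformalStructure.rayModel n) (𝓡 (n + 2)) ∞ ι
  equivariant : ∀ (s : {s : ℝ // 0 < s}) (u : c.RayBundle), ι (s • u) = s • ι u

variable {c : ConformalStructure n p q M} {N : Type*} [TopologicalSpace N]
    [ChartedSpace (EuclideanSpace ℝ (Fin (n + 2))) N] [IsManifold (𝓡 (n + 2)) ∞ N]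
    [MulAction {s : ℝ // 0 < s} N]

namespace AmbientManifold

/-- The infinitesimal generator `X` of the action, `X(x) = d/dt|₀ ρ^{exp t}(x)`; the derivative
is a tangent vector at `ρ^{exp 0}(x) = x`. -/
def generator (_A : AmbientManifold c N) : VecField (n + 2) N := fun x =>
  let v : EuclideanSpace ℝ (Fin (n + 2)) := mfderiv 𝓘(ℝ, ℝ) (𝓡 (n + 2))
    (fun t : ℝ => (⟨Real.exp t, Real.exp_pos t⟩ : {s : ℝ // 0 < s}) • x) 0 (1 : ℝ)
  v

/-- The restriction of `ξ` to `𝒬` is tangent to `𝒬`. -/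
def IsTangent (A : AmbientManifold c N) (ξ : VecField (n + 2) N) : Prop :=
  ∀ u : c.RayBundle, ξ (A.ι u) ∈
    Set.range (mfderiv (ConformalStructure.rayModel n) (𝓡 (n + 2)) A.ι u)

/-- The tangential components of a covariant `2`-tensor field `t` vanish to order `ℓ` along `𝒬`:
for all `k < ℓ`, all `ξ₁, …, ξ_k ∈ 𝔛(N)` and all `η, ζ ∈ 𝔛(N)` that are tangent to `𝒬` along `𝒬`,
the function `ξ_k ⋯ ξ₁ · t(η, ζ)` vanishes on `𝒬`. -/
def TangentialVanishesToOrder (A : AmbientManifold c N) (ℓ : ℕ)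
    (t : VecField (n + 2) N → VecField (n + 2) N → N → ℝ) : Prop :=
  ∀ η ζ : VecField (n + 2) N, SmoothField η → SmoothField ζ → A.IsTangent η → A.IsTangent ζ →
    VanishesToOrder (n + 2) (Set.range A.ι) ℓ (t η ζ)

end AmbientManifold

/-- `h` is an ambient metric on the ambient manifold `A`. -/
structure IsAmbientMetric (A : AmbientManifold c N) (h : BilinField (n + 2) N) : Prop where
  isPseudoRiemannian : IsPseudoRiemannian (p + 1) (q + 1) h
  homogeneous : ∀ ξ η : VecField (n + 2) N, SmoothField ξ → SmoothField η → ∀ x,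
    lieDerivTwo A.generator (pairing h) ξ η x = 2 * pairing h ξ η x
  /-- For `u = g_x ∈ 𝒬` and `ξ, η ∈ T_u 𝒬`: `h(Tι ξ, Tι η) = g_x(Tπ ξ, Tπ η)`. -/
  restrict : ∀ (u : c.RayBundle)
    (ξ η : TangentSpace (ConformalStructure.rayModel n) u),
    h (A.ι u) (mfderiv (ConformalStructure.rayModel n) (𝓡 (n + 2)) A.ι u ξ)
        (mfderiv (ConformalStructure.rayModel n) (𝓡 (n + 2)) A.ι u η) =
      u.form (mfderiv (ConformalStructure.rayModel n) (𝓡 n)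
          (ConformalStructure.RayBundle.proj : c.RayBundle → M) u ξ)
        (mfderiv (ConformalStructure.rayModel n) (𝓡 n)
          (ConformalStructure.RayBundle.proj : c.RayBundle → M) u η)

/-- The one-form `α = h(X, ·)` dual to the generator of the action. -/
def AmbientManifold.dualForm (A : AmbientManifold c N) (h : BilinField (n + 2) N) (x : N) :
    TangentSpace (𝓡 (n + 2)) x →L[ℝ] ℝ := h x (A.generator x)

end Ambient

end

/-! Write h for the metric, ∇ for its Levi-Civita connection, R for its curvature. The equation ℒ_X
h = 2h says that the symmetric part of h(∇X, ·) is h, while dα is twice its skew part; hence dα(ξ,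
η) = 2(h(∇_ξ X, η) - h(ξ, η)) (`IsHomothetic.extDeriv_eq`). As ∇h = 0, differentiating gives
(∇dα)(ζ, ξ, η) = 2 h(∇²_{ζ,ξ} X, η), and skewing in the two derivatives turns the right side into
curvature: 2 h(R(ξ, η)X, ζ) is the sum of two of the three cyclic terms of ∇dα. The cyclic sum is
zero, so the third term remains, with a minus sign (`IsHomothetic.pairing_riemann_eq`). The other
two equalities are the skew and pair symmetries of R.

For the orders, O(r^ℓ) for dα passes to its components, and then (∇dα)(ζ, ξ, η) agrees with ζ ·
dα(ξ, η) modulo O(r^ℓ) (`vanishesToOrder_covDerivTwo_iff`). A general derivative costs one order, a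
tangential one costs none (`VanishesToOrder.dirDeriv_of_tangent`). If ξ and η are tangential but ζ
is not, the cyclic identity trades the derivative along ζ for derivatives along ξ and η. Read
backwards, this makes all first derivatives of tangential components of dα be O(r^ℓ), which is the
extra order. -/

section SmoothFields

/-! ### Smooth functions, smooth vector fields and Lie brackets. -/

variable {m : ℕ} {N : Type*} [TopologicalSpace N] [ChartedSpace (EuclideanSpace ℝ (Fin m)) N]

/-- `f` is a smooth real function on `N`. -/
abbrev SmoothFun (m : ℕ) {N : Type*} [TopologicalSpace N]
    [ChartedSpace (EuclideanSpace ℝ (Fin m)) N] (f : N → ℝ) : Prop :=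
  ContMDiff (𝓡 m) 𝓘(ℝ, ℝ) ∞ f

theorem SmoothFun.mdiff {f : N → ℝ} (hf : SmoothFun m f) (x : N) :
    MDifferentiableAt (𝓡 m) 𝓘(ℝ, ℝ) f x := (hf x).mdifferentiableAt (by simp)

theorem dirDeriv_add_fun {ξ : VecField m N} {f g : N → ℝ} (hf : SmoothFun m f)
    (hg : SmoothFun m g) : dirDeriv ξ (f + g) = dirDeriv ξ f + dirDeriv ξ g := by
  funext x
  simp [dirDeriv, mvfderiv_add (hf.mdiff x) (hg.mdiff x)]

theorem dirDeriv_sub_fun {ξ : VecField m N} {f g : N → ℝ} (hf : SmoothFun m f)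
    (hg : SmoothFun m g) : dirDeriv ξ (f - g) = dirDeriv ξ f - dirDeriv ξ g := by
  funext x
  simp [dirDeriv, mvfderiv_sub (hf.mdiff x) (hg.mdiff x)]

theorem dirDeriv_const_mul {ξ : VecField m N} {f : N → ℝ} (a : ℝ) (hf : SmoothFun m f) :
    dirDeriv ξ (fun x => a * f x) = fun x => a * dirDeriv ξ f x := by
  funext x
  have h1 := mvfderiv_mul (mdifferentiableAt_const (I := 𝓡 m) (I' := 𝓘(ℝ, ℝ)) (x := x) (c := a))
    (hf.mdiff x)
  have h2 : (fun x => a * f x) = (fun _ => a) * f := rfl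
  simp [dirDeriv, h2, h1, mvfderiv_const]

theorem pairing_add_left {h : BilinField m N} (ξ ξ' η : VecField m N) :
    pairing h (ξ + ξ') η = pairing h ξ η + pairing h ξ' η := by
  funext x; simp [pairing]

theorem pairing_add_right {h : BilinField m N} (ξ η η' : VecField m N) :
    pairing h ξ (η + η') = pairing h ξ η + pairing h ξ η' := by
  funext x; simp [pairing]

theorem pairing_sub_left {h : BilinField m N} (ξ ξ' η : VecField m N) :
    pairing h (ξ - ξ') η = pairing h ξ η - pairing h ξ' η := by
  funext x; simp [pairing]

theorem pairing_sub_right {h : BilinField m N} (ξ η η' : VecField m N) :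
    pairing h ξ (η - η') = pairing h ξ η - pairing h ξ η' := by
  funext x; simp [pairing]

theorem pairing_neg_left {h : BilinField m N} (ξ η : VecField m N) :
    pairing h (-ξ) η = -pairing h ξ η := by
  funext x; simp [pairing]

theorem lieBr_swap (ξ η : VecField m N) : lieBr ξ η = -lieBr η ξ := mlieBracket_swap

variable [IsManifold (𝓡 m) ∞ N]

theorem SmoothField.mdiff {ξ : VecField m N} (hξ : SmoothField ξ) (x : N) :
    MDifferentiableAt (𝓡 m) (𝓡 m).tangent (fun y => (⟨y, ξ y⟩ : TangentBundle (𝓡 m) N)) x :=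
  (hξ x).mdifferentiableAt (by simp)

theorem SmoothField.add {ξ η : VecField m N} (hξ : SmoothField ξ) (hη : SmoothField η) :
    SmoothField (ξ + η) := ContMDiff.add_section hξ hη

theorem SmoothField.sub {ξ η : VecField m N} (hξ : SmoothField ξ) (hη : SmoothField η) :
    SmoothField (ξ - η) := ContMDiff.sub_section hξ hη

theorem SmoothField.smul {f : N → ℝ} {ξ : VecField m N} (hf : SmoothFun m f)
    (hξ : SmoothField ξ) : SmoothField (f • ξ) := ContMDiff.smul_section hf hξ

theorem SmoothField.lieBr {ξ η : VecField m N} (hξ : SmoothField ξ) (hη : SmoothField η) :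
    SmoothField (lieBr ξ η) := by
  have : IsManifold (𝓡 m) (minSmoothness ℝ 2) N := by
    rw [minSmoothness_of_isRCLikeNormedField]
    exact IsManifold.of_le (m := 2) (n := ∞) (WithTop.coe_le_coe.2 le_top)
  have : IsManifold (𝓡 m) ((⊤ : ℕ∞) + 1 : WithTop ℕ∞) N := ‹IsManifold (𝓡 m) ∞ N›
  exact ContDiff.mlieBracket_vectorField (m := ⊤) (n := ⊤) hξ hη (by simp)

theorem SmoothFun.dirDeriv {ξ : VecField m N} {f : N → ℝ} (hξ : SmoothField ξ)
    (hf : SmoothFun m f) : SmoothFun m (dirDeriv ξ f) := by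
  have h1 : ContMDiff (𝓡 m).tangent 𝓘(ℝ, ℝ).tangent ∞ (tangentMap (𝓡 m) 𝓘(ℝ, ℝ) f) :=
    hf.contMDiff_tangentMap (by simp)
  exact (contMDiff_snd_tangentBundle_modelSpace ℝ 𝓘(ℝ, ℝ)).comp (h1.comp hξ)

theorem SmoothFun.pairing {p q : ℕ} {h : BilinField m N} (hh : IsPseudoRiemannian p q h)
    {ξ η : VecField m N} (hξ : SmoothField ξ) (hη : SmoothField η) :
    SmoothFun m (pairing h ξ η) := by
  have h1 : ContMDiff (𝓡 m) ((𝓡 m).prod 𝓘(ℝ, ℝ)) ∞ (fun y =>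
      TotalSpace.mk' ℝ (E := Bundle.Trivial N ℝ) y (h y (ξ y) (η y))) :=
    ContMDiff.clm_bundle_apply₂ (F₁ := EuclideanSpace ℝ (Fin m))
      (F₂ := EuclideanSpace ℝ (Fin m)) hh.smooth hξ hη
  intro x
  exact (contMDiffAt_totalSpace.1 (h1 x)).2

/-- A local smooth extension of `v` is cut off by a bump function equal to 1 at `x`. Hence
identities tested on global smooth fields determine tensors pointwise. -/
theorem exists_smoothField_eq [T2Space N] {x : N} (v : TangentSpace (𝓡 m) x) :
    ∃ ξ : VecField m N, SmoothField ξ ∧ ξ x = v := by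
  obtain ⟨s, hs, hsm⟩ := FiberBundle.exists_contMDiffOn_extend (I := 𝓡 m) (k := ∞)
    (EuclideanSpace ℝ (Fin m)) v
  obtain ⟨f, -, hf⟩ := (SmoothBumpFunction.nhds_basis_tsupport (I := 𝓡 m) x).mem_iff.1
    (interior_mem_nhds.2 hs)
  refine ⟨(f : N → ℝ) • FiberBundle.extend (EuclideanSpace ℝ (Fin m)) v, ?_, ?_⟩
  · exact ContMDiffOn.smul_section_of_tsupport f.contMDiff.contMDiffOn isOpen_interior hf
      (hsm.mono interior_subset)
  · simp

theorem lieBr_add_left {ξ ξ' : VecField m N} (hξ : SmoothField ξ)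
    (hξ' : SmoothField ξ') (η : VecField m N) : lieBr (ξ + ξ') η = lieBr ξ η + lieBr ξ' η :=
  funext fun x => mlieBracket_add_left (hξ.mdiff x) (hξ'.mdiff x)

theorem lieBr_add_right {ξ ξ' : VecField m N} (hξ : SmoothField ξ)
    (hξ' : SmoothField ξ') (η : VecField m N) : lieBr η (ξ + ξ') = lieBr η ξ + lieBr η ξ' :=
  funext fun x => mlieBracket_add_right (hξ.mdiff x) (hξ'.mdiff x)

/-- The Jacobi identity. -/
theorem lieBr_lieBr {ξ η ζ : VecField m N} (hξ : SmoothField ξ) (hη : SmoothField η)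
    (hζ : SmoothField ζ) :
    lieBr ξ (lieBr η ζ) = lieBr (lieBr ξ η) ζ + lieBr η (lieBr ξ ζ) := by
  have : IsManifold (𝓡 m) (minSmoothness ℝ 3) N := by
    rw [minSmoothness_of_isRCLikeNormedField]
    exact IsManifold.of_le (m := 3) (n := ∞) (WithTop.coe_le_coe.2 le_top)
  have le2 : (minSmoothness ℝ 2) ≤ ∞ := by
    rw [minSmoothness_of_isRCLikeNormedField]; exact WithTop.coe_le_coe.2 le_top
  exact leibniz_identity_mlieBracket (I := 𝓡 m) (hξ.of_le le2) (hη.of_le le2) (hζ.of_le le2)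

/-- `[ξ, η] · f = ξ · η · f - η · ξ · f`. -/
theorem dirDeriv_lieBr [T2Space N] {ξ η : VecField m N} {f : N → ℝ} (hξ : SmoothField ξ)
    (hη : SmoothField η) (hf : SmoothFun m f) (x : N) :
    dirDeriv (lieBr ξ η) f x = dirDeriv ξ (dirDeriv η f) x - dirDeriv η (dirDeriv ξ f) x := by
  -- The Jacobi identity for ξ, η and f ζ, expanded by the Leibniz rule: after subtracting f times
  -- the identity for ξ, η, ζ, only a multiple of ζ survives, and its coefficient is the claim.
  have key : ∀ ζ : VecField m N, SmoothField ζ →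
      (dirDeriv (lieBr ξ η) f x - (dirDeriv ξ (dirDeriv η f) x - dirDeriv η (dirDeriv ξ f) x))
        • ζ x = 0 := by
    intro ζ hζ
    have hexp : ∀ θ : VecField m N, ∀ g : N → ℝ, SmoothFun m g → ∀ κ : VecField m N,
        SmoothField κ → lieBr θ (g • κ) = dirDeriv θ g • κ + g • lieBr θ κ := by
      intro θ g hg κ hκ
      funext y
      exact mlieBracket_smul_right (hg.mdiff y) (hκ.mdiff y)
    have hj := lieBr_lieBr hξ hη (hζ.smul hf)
    have hj' := lieBr_lieBr hξ hη hζ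
    rw [hexp η f hf ζ hζ, hexp ξ f hf ζ hζ, hexp _ f hf ζ hζ,
      lieBr_add_right (hζ.smul (hf.dirDeriv hη)) ((hη.lieBr hζ).smul hf),
      lieBr_add_right (hζ.smul (hf.dirDeriv hξ)) ((hξ.lieBr hζ).smul hf),
      hexp _ _ (hf.dirDeriv hη) _ hζ, hexp _ _ (hf.dirDeriv hξ) _ hζ,
      hexp _ _ hf _ (hη.lieBr hζ), hexp _ _ hf _ (hξ.lieBr hζ), hj'] at hj
    have hx := congrFun hj x
    simp only [Pi.add_apply, Pi.smul_apply'] at hx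
    linear_combination (norm := module) -hx
  -- A nonzero value of ζ is needed to cancel it; if the tangent space is zero, both sides are
  -- trivially 0.
  by_cases hx : ∃ v : TangentSpace (𝓡 m) x, v ≠ 0
  · obtain ⟨v, hv⟩ := hx
    obtain ⟨ζ, hζ, rfl⟩ := exists_smoothField_eq v
    exact sub_eq_zero.1 ((smul_eq_zero.1 (key ζ hζ)).resolve_right hv)
  · push Not at hx
    simp [dirDeriv, hx]

end SmoothFields

/-! ### The Levi-Civita connection: smoothness, compatibility, torsion. -/

section LeviCivita

variable {m : ℕ} {N : Type*} [TopologicalSpace N] [ChartedSpace (EuclideanSpace ℝ (Fin m)) N]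
    [IsManifold (𝓡 m) ∞ N] {p q : ℕ} {h : BilinField m N}

theorem IsPseudoRiemannian.symm (hh : IsPseudoRiemannian p q h) (x : N)
    (v w : TangentSpace (𝓡 m) x) : h x v w = h x w v :=
  HasSignature.symm' (B := (ContinuousLinearMap.coeLM ℝ).comp (h x).toLinearMap)
    (hh.signature x) v w

theorem IsPseudoRiemannian.pairing_comm (hh : IsPseudoRiemannian p q h) (ξ η : VecField m N) :
    pairing h ξ η = pairing h η ξ := funext fun x => hh.symm x _ _

theorem IsPseudoRiemannian.eq_zero (hh : IsPseudoRiemannian p q h) {x : N}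
    {v : TangentSpace (𝓡 m) x} (hv : ∀ w, h x v w = 0) : v = 0 := by
  have hfree : Module.Projective ℝ (TangentSpace (𝓡 m) x) :=
    inferInstanceAs (Module.Projective ℝ (EuclideanSpace ℝ (Fin m)))
  rw [← Module.forall_dual_apply_eq_zero_iff ℝ]
  intro φ
  obtain ⟨u, hu⟩ := HasSignature.exists_dual
    (B := (ContinuousLinearMap.coeLM ℝ).comp (h x).toLinearMap) (hh.signature x) φ
  rw [← hu v]
  exact (hh.symm x u v).trans (hv u)

theorem IsPseudoRiemannian.ext [T2Space N] (hh : IsPseudoRiemannian p q h) {x : N}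
    {v w : TangentSpace (𝓡 m) x}
    (hvw : ∀ ζ : VecField m N, SmoothField ζ → h x v (ζ x) = h x w (ζ x)) : v = w := by
  rw [← sub_eq_zero]
  refine hh.eq_zero fun u => ?_
  obtain ⟨ζ, hζ, rfl⟩ := exists_smoothField_eq u
  simp [hvw ζ hζ]

/-- A vector field is smooth if its pairings with all smooth vector fields are smooth. -/
theorem smoothField_of_pairing [T2Space N] (hh : IsPseudoRiemannian p q h) {V : VecField m N}
    (hV : ∀ ζ : VecField m N, SmoothField ζ → SmoothFun m (pairing h V ζ)) : SmoothField V := by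
  intro x₀
  -- A basis diagonalising `h` at `x₀` is extended to smooth fields `e i`, and V is expanded in them
  -- near `x₀` by inverting their Gram matrix.
  obtain ⟨b, hb⟩ := hh.signature x₀
  choose e he heb using fun i => exists_smoothField_eq (N := N) (b i)
  let ι := Fin p ⊕ Fin q
  have hcard : Fintype.card ι = m := by
    rw [← Module.finrank_eq_card_basis b]
    exact finrank_euclideanSpace_fin (𝕜 := ℝ) (n := m)
  let T : ι → ι → (ι → ℝ) →L[ℝ] (ι → ℝ) := fun i j =>
    (ContinuousLinearMap.single ℝ (fun _ : ι => ℝ) j).comp (ContinuousLinearMap.proj i)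
  let A : N → (ι → ℝ) →L[ℝ] (ι → ℝ) := fun y => ∑ i, ∑ j, pairing h (e i) (e j) y • T i j
  have hA : ∀ y a j, A y a j = ∑ i, pairing h (e i) (e j) y * a i := by
    intro y a j
    simp only [A, T, sum_apply, Finset.sum_apply,
      smul_apply, ContinuousLinearMap.comp_apply,
      ContinuousLinearMap.proj_apply, ContinuousLinearMap.single_apply, Pi.smul_apply, smul_eq_mul,
      Pi.single_apply]
    simp
  have hA' : ∀ y a j, A y a j = h y (∑ i, a i • e i y) (e j y) := by
    intro y a j
    rw [hA]
    simp [pairing, mul_comm, -Fintype.sum_sum_type]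
    rfl
  have hAsm : ContMDiff (𝓡 m) 𝓘(ℝ, (ι → ℝ) →L[ℝ] (ι → ℝ)) ∞ A := by
    refine contMDiff_finsetSum fun i _ => contMDiff_finsetSum fun j _ => ?_
    exact (SmoothFun.pairing hh (he i) (he j)).smul contMDiff_const
  -- At `x₀` the Gram matrix is diag(±1), its own inverse. So it is a unit, near which
  -- `Ring.inverse` is smooth.
  have hA0 : A x₀ * A x₀ = 1 := by
    have h0 : ∀ a j, A x₀ a j = Sum.elim (fun _ => 1) (fun _ => -1) j * a j := by
      intro a j
      simp only [hA, pairing, heb, hb, ite_mul, zero_mul, Finset.sum_ite_eq', Finset.mem_univ,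
        if_true]
    ext a j
    change A x₀ (A x₀ _) j = _
    rw [h0, h0]
    rcases j with j | j <;> simp
  let u : ((ι → ℝ) →L[ℝ] (ι → ℝ))ˣ := ⟨A x₀, A x₀, hA0, hA0⟩
  have hinv : ContMDiffAt (𝓡 m) 𝓘(ℝ, (ι → ℝ) →L[ℝ] (ι → ℝ)) ∞ (fun y => Ring.inverse (A y)) x₀ :=
    (contDiffAt_ringInverse ℝ u).contMDiffAt.comp x₀ (hAsm x₀)
  let β : N → ι → ℝ := fun y j => pairing h V (e j) y
  have hβ : ContMDiff (𝓡 m) 𝓘(ℝ, ι → ℝ) ∞ β := contMDiff_pi_space.2 fun j => hV _ (he j)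
  let c : N → ι → ℝ := fun y => Ring.inverse (A y) (β y)
  have hc : ContMDiffAt (𝓡 m) 𝓘(ℝ, ι → ℝ) ∞ c x₀ := hinv.clm_apply (hβ x₀)
  -- Where the Gram matrix is invertible, the `e i` are independent, hence a frame by counting. Then
  -- V and Σ cᵢ eᵢ have equal pairings with the frame, and nondegeneracy concludes.
  have hev : ∀ᶠ y in 𝓝 x₀, V y = ∑ i, c y i • e i y := by
    have hu : ∀ᶠ y in 𝓝 x₀, IsUnit (A y) :=
      hAsm.continuous.continuousAt.eventually (Units.nhds u)
    filter_upwards [hu] with y hy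
    have hfin : Module.finrank ℝ (TangentSpace (𝓡 m) y) = m :=
      finrank_euclideanSpace_fin (𝕜 := ℝ) (n := m)
    have : FiniteDimensional ℝ (TangentSpace (𝓡 m) y) :=
      inferInstanceAs (FiniteDimensional ℝ (EuclideanSpace ℝ (Fin m)))
    have hli : LinearIndependent ℝ (fun i => e i y) := by
      rw [Fintype.linearIndependent_iff]
      intro a ha
      have h0 : A y a = 0 := by
        funext j
        rw [hA', ha]
        simp
      have h1 : Ring.inverse (A y) (A y a) = a :=
        congrArg (fun B : (ι → ℝ) →L[ℝ] (ι → ℝ) => B a) (Ring.inverse_mul_cancel _ hy)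
      rw [h0, map_zero] at h1
      exact fun i => (congrFun h1 i).symm
    have hspan := hli.span_eq_top_of_card_eq_finrank' (by rw [hfin]; exact hcard)
    have h2 : A y (c y) = β y :=
      congrArg (fun B : (ι → ℝ) →L[ℝ] (ι → ℝ) => B (β y)) (Ring.mul_inverse_cancel _ hy)
    rw [← sub_eq_zero]
    refine hh.eq_zero fun w => ?_
    have hker : Submodule.span ℝ (Set.range fun i => e i y) ≤
        LinearMap.ker (h y (V y - ∑ i, c y i • e i y)).toLinearMap := by
      rw [Submodule.span_le]
      rintro _ ⟨j, rfl⟩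
      have h3 := congrFun h2 j
      rw [hA'] at h3
      change h y (V y - ∑ i, c y i • e i y) (e j y) = 0
      rw [map_sub, sub_apply, h3]
      exact sub_self _
    rw [hspan] at hker
    exact hker (Submodule.mem_top (x := w))
  have hsum : ContMDiffAt (𝓡 m) (𝓡 m).tangent ∞
      (fun y => (⟨y, ∑ i, c y i • e i y⟩ : TangentBundle (𝓡 m) N)) x₀ :=
    ContMDiffAt.sum_section fun i _ =>
      ContMDiffAt.smul_section (contMDiffAt_pi_space.1 hc i) (he i x₀)
  refine hsum.congr_of_eventuallyEq ?_
  filter_upwards [hev] with y hy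
  rw [hy]

theorem SmoothFun.koszul (hh : IsPseudoRiemannian p q h) {ξ η ζ : VecField m N}
    (hξ : SmoothField ξ) (hη : SmoothField η) (hζ : SmoothField ζ) :
    SmoothFun m (koszul h ξ η ζ) :=
  ((((((SmoothFun.pairing hh hη hζ).dirDeriv hξ).add
    ((SmoothFun.pairing hh hξ hζ).dirDeriv hη)).sub
    ((SmoothFun.pairing hh hξ hη).dirDeriv hζ)).add
    (SmoothFun.pairing hh (hξ.lieBr hη) hζ)).sub
    (SmoothFun.pairing hh (hξ.lieBr hζ) hη)).sub
    (SmoothFun.pairing hh (hη.lieBr hζ) hξ)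

/-- The Levi-Civita connection is compatible with the metric. -/
theorem dirDeriv_pairing (hh : IsPseudoRiemannian p q h) {ζ ξ η : VecField m N}
    (hζ : SmoothField ζ) (hξ : SmoothField ξ) (hη : SmoothField η) (x : N) :
    dirDeriv ζ (pairing h ξ η) x =
      pairing h (leviCivita h ζ ξ) η x + pairing h ξ (leviCivita h ζ η) x := by
  -- In the sum of these two Koszul formulas everything cancels except 2 ζ · h(ξ, η).
  have h1 := leviCivita_spec hh hζ hξ hη x
  have h2 := leviCivita_spec hh hζ hη hξ x
  rw [hh.pairing_comm ξ (leviCivita h ζ η)]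
  simp only [koszul, lieBr_swap η ξ, hh.pairing_comm η ξ, pairing_neg_left, Pi.neg_apply]
    at h1 h2
  simp only [pairing_apply h (leviCivita h _ _)]
  linarith

variable [T2Space N]

/-- `leviCivita` picks a vector at each point separately; smoothness is recovered from its pairings,
which are half the smooth Koszul expressions. -/
theorem SmoothField.leviCivita (hh : IsPseudoRiemannian p q h) {ξ η : VecField m N}
    (hξ : SmoothField ξ) (hη : SmoothField η) : SmoothField (leviCivita h ξ η) := by
  refine smoothField_of_pairing hh fun ζ hζ => ?_
  have : pairing h (_root_.leviCivita h ξ η) ζ = fun x => (1 / 2 : ℝ) * _root_.koszul h ξ η ζ x := by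
    funext x
    rw [← leviCivita_spec hh hξ hη hζ x, pairing]
    ring
  rw [this]
  exact contMDiff_const.mul (SmoothFun.koszul hh hξ hη hζ)

/-- Uniqueness in the Koszul formula, by nondegeneracy; additivity in both arguments follows from
it. -/
theorem leviCivita_eq (hh : IsPseudoRiemannian p q h) {ξ η V : VecField m N}
    (hξ : SmoothField ξ) (hη : SmoothField η)
    (hV : ∀ ζ : VecField m N, SmoothField ζ → ∀ x, 2 * pairing h V ζ x = koszul h ξ η ζ x) :
    leviCivita h ξ η = V := by
  funext x
  refine hh.ext fun ζ hζ => ?_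
  have h1 := leviCivita_spec hh hξ hη hζ x
  have h2 := hV ζ hζ x
  simp only [pairing] at h2
  linarith

theorem leviCivita_add_left (hh : IsPseudoRiemannian p q h) {ξ ξ' η : VecField m N}
    (hξ : SmoothField ξ) (hξ' : SmoothField ξ') (hη : SmoothField η) :
    leviCivita h (ξ + ξ') η = leviCivita h ξ η + leviCivita h ξ' η := by
  refine leviCivita_eq hh (hξ.add hξ') hη fun ζ hζ x => ?_
  have h1 := leviCivita_spec hh hξ hη hζ x
  have h2 := leviCivita_spec hh hξ' hη hζ x
  simp only [koszul, pairing_add_left, pairing_add_right, lieBr_add_left hξ hξ',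
    dirDeriv_add_fun (SmoothFun.pairing hh hξ hη) (SmoothFun.pairing hh hξ' hη),
    dirDeriv_add_fun (SmoothFun.pairing hh hξ hζ) (SmoothFun.pairing hh hξ' hζ),
    Pi.add_apply] at h1 h2 ⊢
  have h3 : dirDeriv (ξ + ξ') (pairing h η ζ) x =
      dirDeriv ξ (pairing h η ζ) x + dirDeriv ξ' (pairing h η ζ) x := by simp [dirDeriv]
  rw [h3, pairing, pairing]
  linarith

theorem leviCivita_add_right (hh : IsPseudoRiemannian p q h) {ξ η η' : VecField m N}
    (hξ : SmoothField ξ) (hη : SmoothField η) (hη' : SmoothField η') :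
    leviCivita h ξ (η + η') = leviCivita h ξ η + leviCivita h ξ η' := by
  refine leviCivita_eq hh hξ (hη.add hη') fun ζ hζ x => ?_
  have h1 := leviCivita_spec hh hξ hη hζ x
  have h2 := leviCivita_spec hh hξ hη' hζ x
  simp only [koszul, pairing_add_left, pairing_add_right, lieBr_add_right hη hη',
    lieBr_add_left hη hη',
    dirDeriv_add_fun (SmoothFun.pairing hh hξ hη) (SmoothFun.pairing hh hξ hη'),
    dirDeriv_add_fun (SmoothFun.pairing hh hη hζ) (SmoothFun.pairing hh hη' hζ),
    Pi.add_apply] at h1 h2 ⊢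
  have h3 : dirDeriv (η + η') (pairing h ξ ζ) x =
      dirDeriv η (pairing h ξ ζ) x + dirDeriv η' (pairing h ξ ζ) x := by simp [dirDeriv]
  rw [h3, pairing, pairing]
  linarith

theorem leviCivita_sub_left (hh : IsPseudoRiemannian p q h) {ξ ξ' η : VecField m N}
    (hξ : SmoothField ξ) (hξ' : SmoothField ξ') (hη : SmoothField η) :
    leviCivita h (ξ - ξ') η = leviCivita h ξ η - leviCivita h ξ' η := by
  rw [eq_sub_iff_add_eq, ← leviCivita_add_left hh (hξ.sub hξ') hξ' hη, sub_add_cancel]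

theorem leviCivita_sub_right (hh : IsPseudoRiemannian p q h) {ξ η η' : VecField m N}
    (hξ : SmoothField ξ) (hη : SmoothField η) (hη' : SmoothField η') :
    leviCivita h ξ (η - η') = leviCivita h ξ η - leviCivita h ξ η' := by
  rw [eq_sub_iff_add_eq, ← leviCivita_add_right hh hξ (hη.sub hη') hη', sub_add_cancel]

/-- The Levi-Civita connection is torsion free. -/
theorem lieBr_eq_leviCivita_sub (hh : IsPseudoRiemannian p q h) {ξ η : VecField m N}
    (hξ : SmoothField ξ) (hη : SmoothField η) :
    lieBr ξ η = leviCivita h ξ η - leviCivita h η ξ := by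
  funext x
  refine hh.ext fun ζ hζ => ?_
  have h1 := leviCivita_spec hh hξ hη hζ x
  have h2 := leviCivita_spec hh hη hξ hζ x
  simp only [koszul, lieBr_swap η ξ, hh.pairing_comm η ξ, pairing_neg_left, Pi.neg_apply]
    at h1 h2
  have h3 : pairing h (lieBr ξ η) ζ x = h x (lieBr ξ η x) (ζ x) := rfl
  rw [Pi.sub_apply, map_sub, sub_apply, ← h3]
  linarith

end LeviCivita

/-! ### Symmetries of the Riemann curvature. -/

section Curvature

variable {m : ℕ} {N : Type*} [TopologicalSpace N] [ChartedSpace (EuclideanSpace ℝ (Fin m)) N]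
    [IsManifold (𝓡 m) ∞ N] {p q : ℕ} {h : BilinField m N}

theorem riemann_eq (ξ η ζ : VecField m N) :
    riemann h ξ η ζ = leviCivita h ξ (leviCivita h η ζ) - leviCivita h η (leviCivita h ξ ζ)
      - leviCivita h (lieBr ξ η) ζ := rfl

variable [T2Space N]

/-- Removes the bracket from the curvature, leaving only iterated ∇. -/
theorem leviCivita_lieBr (hh : IsPseudoRiemannian p q h) {ξ η ζ : VecField m N}
    (hξ : SmoothField ξ) (hη : SmoothField η) (hζ : SmoothField ζ) :
    leviCivita h (lieBr ξ η) ζ =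
      leviCivita h (leviCivita h ξ η) ζ - leviCivita h (leviCivita h η ξ) ζ := by
  rw [lieBr_eq_leviCivita_sub hh hξ hη,
    leviCivita_sub_left hh (hξ.leviCivita hh hη) (hη.leviCivita hh hξ) hζ]

theorem riemann_swap (hh : IsPseudoRiemannian p q h) {ξ η ζ : VecField m N}
    (hξ : SmoothField ξ) (hη : SmoothField η) (hζ : SmoothField ζ) :
    riemann h η ξ ζ = -riemann h ξ η ζ := by
  rw [riemann_eq, riemann_eq, leviCivita_lieBr hh hξ hη hζ, leviCivita_lieBr hh hη hξ hζ]
  abel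

/-- Apply [ξ, η] = ξη - ηξ to the function h(ζ, κ) and expand by metric compatibility; the mixed
terms h(∇ζ, ∇κ) are symmetric in ξ, η and cancel. -/
theorem pairing_riemann_swap (hh : IsPseudoRiemannian p q h) {ξ η ζ κ : VecField m N}
    (hξ : SmoothField ξ) (hη : SmoothField η) (hζ : SmoothField ζ) (hκ : SmoothField κ) (x : N) :
    pairing h (riemann h ξ η ζ) κ x = -pairing h (riemann h ξ η κ) ζ x := by
  have hsec : ∀ {a b : VecField m N}, SmoothField a → SmoothField b →
      dirDeriv a (dirDeriv b (pairing h ζ κ)) x =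
        pairing h (leviCivita h a (leviCivita h b ζ)) κ x
        + pairing h (leviCivita h b ζ) (leviCivita h a κ) x
        + (pairing h (leviCivita h a ζ) (leviCivita h b κ) x
        + pairing h ζ (leviCivita h a (leviCivita h b κ)) x) := by
    intro a b ha hb
    have h1 : dirDeriv b (pairing h ζ κ) =
        pairing h (leviCivita h b ζ) κ + pairing h ζ (leviCivita h b κ) :=
      funext (dirDeriv_pairing hh hb hζ hκ)
    rw [h1, dirDeriv_add_fun (SmoothFun.pairing hh (hb.leviCivita hh hζ) hκ)
      (SmoothFun.pairing hh hζ (hb.leviCivita hh hκ)), Pi.add_apply,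
      dirDeriv_pairing hh ha (hb.leviCivita hh hζ) hκ,
      dirDeriv_pairing hh ha hζ (hb.leviCivita hh hκ)]
  have h1 := dirDeriv_lieBr hξ hη (SmoothFun.pairing hh hζ hκ) x
  rw [hsec hξ hη, hsec hη hξ, dirDeriv_pairing hh (hξ.lieBr hη) hζ hκ] at h1
  rw [hh.pairing_comm (riemann h ξ η κ)]
  simp only [riemann_eq, pairing_sub_left, pairing_sub_right, Pi.sub_apply]
  linarith

/-- The first Bianchi identity. -/
theorem riemann_bianchi (hh : IsPseudoRiemannian p q h) {ξ η ζ : VecField m N}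
    (hξ : SmoothField ξ) (hη : SmoothField η) (hζ : SmoothField ζ) :
    riemann h ξ η ζ + riemann h η ζ ξ + riemann h ζ ξ η = 0 := by
  have hbr : ∀ {a b c : VecField m N}, SmoothField a → SmoothField b → SmoothField c →
      lieBr a (lieBr b c) = leviCivita h a (leviCivita h b c) - leviCivita h a (leviCivita h c b)
        - leviCivita h (lieBr b c) a := by
    intro a b c ha hb hc
    rw [lieBr_eq_leviCivita_sub hh ha (hb.lieBr hc)]
    congr 1
    rw [lieBr_eq_leviCivita_sub hh hb hc,
      leviCivita_sub_right hh ha (hb.leviCivita hh hc) (hc.leviCivita hh hb)]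
  -- Bianchi is the Jacobi identity in cyclic form, with each double bracket expanded by
  -- torsion-freeness (`hbr`).
  have hj := lieBr_lieBr hξ hη hζ
  have hneg : lieBr η (lieBr ξ ζ) = -lieBr η (lieBr ζ ξ) := by
    have h1 := lieBr_add_right (hξ.lieBr hζ) (hζ.lieBr hξ) η
    rw [lieBr_swap ζ ξ, add_neg_cancel] at h1
    rw [lieBr_swap ζ ξ, eq_neg_iff_add_eq_zero, ← h1]
    exact mlieBracket_zero_right
  rw [lieBr_swap (lieBr ξ η) ζ, hneg, hbr hξ hη hζ, hbr hζ hξ hη, hbr hη hζ hξ] at hj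
  simp only [riemann_eq]
  rw [← sub_eq_zero] at hj
  rw [← hj]
  abel

/-- The pair symmetry of the curvature. -/
theorem pairing_riemann_pair_symm (hh : IsPseudoRiemannian p q h) {ξ η ζ κ : VecField m N}
    (hξ : SmoothField ξ) (hη : SmoothField η) (hζ : SmoothField ζ) (hκ : SmoothField κ) (x : N) :
    pairing h (riemann h ξ η ζ) κ x = pairing h (riemann h ζ κ ξ) η x := by
  have hB : ∀ {a b c d : VecField m N}, SmoothField a → SmoothField b → SmoothField c →
      SmoothField d → pairing h (riemann h a b c) d x + pairing h (riemann h b c a) d x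
        + pairing h (riemann h c a b) d x = 0 := by
    intro a b c d ha hb hc hd
    have h1 := congrArg (fun V => pairing h V d x) (riemann_bianchi hh ha hb hc)
    simp only [pairing_add_left, Pi.add_apply] at h1
    rw [h1]
    simp [pairing]
  have hA : ∀ {a b c d : VecField m N}, SmoothField a → SmoothField b → SmoothField c →
      SmoothField d → pairing h (riemann h b a c) d x = -pairing h (riemann h a b c) d x := by
    intro a b c d ha hb hc hd
    rw [riemann_swap hh ha hb hc, pairing_neg_left, Pi.neg_apply]
  -- The octahedron argument: four Bianchi identities, one for each choice of last entry, whose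
  -- terms are matched up to sign by the two skew symmetries.
  linarith [hB hξ hη hζ hκ, hB hη hζ hκ hξ, hB hζ hκ hξ hη, hB hκ hξ hη hζ,
    pairing_riemann_swap hh hξ hη hζ hκ x, pairing_riemann_swap hh hη hζ hξ hκ x,
    pairing_riemann_swap hh hζ hξ hη hκ x, pairing_riemann_swap hh hζ hκ hη hξ x,
    pairing_riemann_swap hh hκ hη hζ hξ x, pairing_riemann_swap hh hκ hξ hζ hη x,
    hA hη hξ hζ hκ, hA hζ hη hξ hκ, hA hζ hξ hη hκ, hA hκ hζ hη hξ, hA hκ hη hζ hξ,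
    hA hκ hξ hζ hη, hA hη hξ hκ hζ, hA hζ hη hκ hξ, hA hζ hξ hκ hη, hA hκ hζ hξ hη,
    hA hκ hη hξ hζ, hA hκ hξ hη hζ]

end Curvature

/-! ### Homothetic fields: curvature in terms of ∇dα. -/

section Homothetic

variable {m : ℕ} {N : Type*} [TopologicalSpace N] [ChartedSpace (EuclideanSpace ℝ (Fin m)) N]
    {h : BilinField m N} {X : VecField m N}

/-- The two-form `dα` for `α = h(X, ·)`. -/
noncomputable abbrev extDerivDual (h : BilinField m N) (X : VecField m N) :
    VecField m N → VecField m N → N → ℝ :=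
  extDerivOne fun x => h x (X x)

theorem extDerivDual_swap (ξ η : VecField m N) :
    extDerivDual h X ξ η = -extDerivDual h X η ξ := by
  funext x
  simp only [extDerivDual, extDerivOne, lieBr_swap ξ η, Pi.neg_apply, map_neg]
  ring

variable [IsManifold (𝓡 m) ∞ N] {p q : ℕ}

theorem covDerivTwo_extDerivDual_swap (ζ ξ η : VecField m N) (x : N) :
    covDerivTwo h (extDerivDual h X) ζ ξ η x = -covDerivTwo h (extDerivDual h X) ζ η ξ x := by
  simp only [covDerivTwo]
  rw [extDerivDual_swap ξ η, extDerivDual_swap (leviCivita h ζ ξ) η,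
    extDerivDual_swap ξ (leviCivita h ζ η)]
  simp only [dirDeriv, mvfderiv_neg, Pi.neg_apply, neg_apply]
  ring


/-- `X` is a smooth vector field with `ℒ_X h = 2h`. -/
structure IsHomothetic (h : BilinField m N) (X : VecField m N) : Prop where
  smooth : SmoothField X
  lieDeriv : ∀ ξ η : VecField m N, SmoothField ξ → SmoothField η → ∀ x,
    lieDerivTwo X (pairing h) ξ η x = 2 * pairing h ξ η x

variable [T2Space N]

/-- For a homothetic field, `2 h(∇_ξ X, η) = 2 h(ξ, η) + dα(ξ, η)`. -/
theorem IsHomothetic.extDeriv_eq (hX : IsHomothetic h X) (hh : IsPseudoRiemannian p q h)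
    {ξ η : VecField m N} (hξ : SmoothField ξ) (hη : SmoothField η) (x : N) :
    extDerivDual h X ξ η x = 2 * (pairing h (leviCivita h ξ X) η x - pairing h ξ η x) := by
  have h1 := hX.lieDeriv ξ η hξ hη x
  have h2 : extDerivDual h X ξ η x = dirDeriv ξ (pairing h X η) x - dirDeriv η (pairing h X ξ) x
    - pairing h X (lieBr ξ η) x := rfl
  simp only [lieDerivTwo, dirDeriv_pairing hh hX.smooth hξ hη,
    lieBr_eq_leviCivita_sub hh hX.smooth hξ, lieBr_eq_leviCivita_sub hh hX.smooth hη,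
    pairing_sub_left, pairing_sub_right, Pi.sub_apply] at h1
  rw [dirDeriv_pairing hh hξ hX.smooth hη, dirDeriv_pairing hh hη hX.smooth hξ,
    lieBr_eq_leviCivita_sub hh hξ hη, pairing_sub_right, Pi.sub_apply,
    hh.pairing_comm (leviCivita h η X) ξ] at h2
  -- Here `h1` amounts to h(∇_ξ X, η) + h(ξ, ∇_η X) = 2 h(ξ, η), and `h2` expresses dα(ξ, η) as the
  -- corresponding difference; add them.
  linarith

theorem IsHomothetic.smooth_extDeriv (hX : IsHomothetic h X) (hh : IsPseudoRiemannian p q h)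
    {ξ η : VecField m N} (hξ : SmoothField ξ) (hη : SmoothField η) :
    SmoothFun m (extDerivDual h X ξ η) := by
  rw [funext (hX.extDeriv_eq hh hξ hη)]
  exact contMDiff_const.mul ((SmoothFun.pairing hh (hξ.leviCivita hh hX.smooth) hη).sub
    (SmoothFun.pairing hh hξ hη))

/-- The right side is 2 h(∇²_{ζ,ξ} X, η). In the derivative of `extDeriv_eq` the term h(ξ, η)
disappears because ∇h = 0. -/
theorem IsHomothetic.covDeriv_eq (hX : IsHomothetic h X) (hh : IsPseudoRiemannian p q h)
    {ζ ξ η : VecField m N} (hζ : SmoothField ζ) (hξ : SmoothField ξ) (hη : SmoothField η) (x : N) :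
    covDerivTwo h (extDerivDual h X) ζ ξ η x =
      2 * (pairing h (leviCivita h ζ (leviCivita h ξ X)) η x
        - pairing h (leviCivita h (leviCivita h ζ ξ) X) η x) := by
  have h0 := SmoothFun.pairing hh (hξ.leviCivita hh hX.smooth) hη
  have h1 := SmoothFun.pairing hh hξ hη
  have h2 : extDerivDual h X ξ η =
      fun x => 2 * (pairing h (leviCivita h ξ X) η - pairing h ξ η) x :=
    funext (hX.extDeriv_eq hh hξ hη)
  rw [covDerivTwo, hX.extDeriv_eq hh (hζ.leviCivita hh hξ) hη,
    hX.extDeriv_eq hh hξ (hζ.leviCivita hh hη), h2,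
    dirDeriv_const_mul (f := pairing h (leviCivita h ξ X) η - pairing h ξ η) 2 (h0.sub h1),
    dirDeriv_sub_fun h0 h1]
  simp only [Pi.sub_apply]
  rw [dirDeriv_pairing hh hζ (hξ.leviCivita hh hX.smooth) hη, dirDeriv_pairing hh hζ hξ hη]
  ring

/-- R(ξ, η)X is the skew part of ∇²X; skewness of dα turns the difference into a sum of two cyclic
terms. -/
theorem IsHomothetic.two_mul_riemann (hX : IsHomothetic h X) (hh : IsPseudoRiemannian p q h)
    {ξ η ζ : VecField m N} (hξ : SmoothField ξ) (hη : SmoothField η) (hζ : SmoothField ζ) (x : N) :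
    2 * pairing h (riemann h ξ η X) ζ x =
      covDerivTwo h (extDerivDual h X) ξ η ζ x + covDerivTwo h (extDerivDual h X) η ζ ξ x := by
  rw [covDerivTwo_extDerivDual_swap η ζ ξ, hX.covDeriv_eq hh hξ hη hζ,
    hX.covDeriv_eq hh hη hξ hζ, riemann_eq, leviCivita_lieBr hh hξ hη hX.smooth]
  simp only [pairing_sub_left, Pi.sub_apply]
  ring

/-- The two-form `dα` is closed. -/
theorem IsHomothetic.covDeriv_cyclic (hX : IsHomothetic h X) (hh : IsPseudoRiemannian p q h)
    {ξ η ζ : VecField m N} (hξ : SmoothField ξ) (hη : SmoothField η) (hζ : SmoothField ζ) (x : N) :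
    covDerivTwo h (extDerivDual h X) ξ η ζ x + covDerivTwo h (extDerivDual h X) η ζ ξ x
      + covDerivTwo h (extDerivDual h X) ζ ξ η x = 0 := by
  -- Bianchi paired with X, moved onto X by skewness, makes the cyclic sum of h(R(ξ, η)X, ζ) zero.
  -- By `two_mul_riemann` twice that sum counts each cyclic term of ∇dα twice.
  have h1 := congrArg (fun V => pairing h V X x) (riemann_bianchi hh hξ hη hζ)
  simp only [pairing_add_left, Pi.add_apply, pairing_riemann_swap hh hξ hη hζ hX.smooth,
    pairing_riemann_swap hh hη hζ hξ hX.smooth, pairing_riemann_swap hh hζ hξ hη hX.smooth] at h1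
  have h2 : pairing h (0 : VecField m N) X x = 0 := by simp [pairing]
  linarith [hX.two_mul_riemann hh hξ hη hζ x, hX.two_mul_riemann hh hη hζ hξ x,
    hX.two_mul_riemann hh hζ hξ hη x]

theorem IsHomothetic.pairing_riemann_eq (hX : IsHomothetic h X) (hh : IsPseudoRiemannian p q h)
    {ξ η ζ : VecField m N} (hξ : SmoothField ξ) (hη : SmoothField η) (hζ : SmoothField ζ) (x : N) :
    pairing h (riemann h ξ η X) ζ x =
      -(1 / 2) * covDerivTwo h (extDerivDual h X) ζ ξ η x := by
  linarith [hX.two_mul_riemann hh hξ hη hζ x, hX.covDeriv_cyclic hh hξ hη hζ x]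

end Homothetic

/-! ### Calculus of orders of vanishing. -/

section Vanishing

variable {m : ℕ} {N : Type*} [TopologicalSpace N] [ChartedSpace (EuclideanSpace ℝ (Fin m)) N]
    [IsManifold (𝓡 m) ∞ N] {Q : Set N} {ℓ : ℕ}

theorem vanishesToOrder_zero (f : N → ℝ) : VanishesToOrder m Q 0 f :=
  fun _ hL => absurd hL (Nat.not_lt_zero _)

theorem VanishesToOrder.mono {f : N → ℝ} {k : ℕ} (hf : VanishesToOrder m Q ℓ f) (hk : k ≤ ℓ) :
    VanishesToOrder m Q k f :=
  fun L hL => hf L (hL.trans_le hk)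

/-- The basis for induction on the order. `foldr` applies the last entry of the list first, so the
derivative split off is the innermost one. -/
theorem vanishesToOrder_succ_iff {f : N → ℝ} :
    VanishesToOrder m Q (ℓ + 1) f ↔ (∀ u ∈ Q, f u = 0) ∧
      ∀ ξ : VecField m N, SmoothField ξ → VanishesToOrder m Q ℓ (dirDeriv ξ f) := by
  refine ⟨fun hf => ⟨hf [] (by simp) (by simp), fun ξ hξ L hL hLs u hu => ?_⟩, ?_⟩
  · have h1 := hf (L ++ [ξ]) (by simpa using hL)
      (by simpa [or_imp, forall_and] using ⟨hLs, hξ⟩) u hu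
    simpa using h1
  · rintro ⟨h0, h1⟩ L hL hLs u hu
    obtain rfl | ⟨L', ξ, rfl⟩ := L.eq_nil_or_concat'
    · exact h0 u hu
    · rw [List.foldr_append]
      exact h1 ξ (hLs ξ (by simp)) L' (by simpa using hL) (fun θ hθ => hLs θ (by simp [hθ])) u hu

theorem VanishesToOrder.add {f g : N → ℝ} (hfs : SmoothFun m f) (hgs : SmoothFun m g)
    (hf : VanishesToOrder m Q ℓ f) (hg : VanishesToOrder m Q ℓ g) :
    VanishesToOrder m Q ℓ (f + g) := by
  induction ℓ generalizing f g with
  | zero => exact vanishesToOrder_zero _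
  | succ ℓ ih =>
    rw [vanishesToOrder_succ_iff] at hf hg ⊢
    refine ⟨fun u hu => by simp [hf.1 u hu, hg.1 u hu], fun ξ hξ => ?_⟩
    rw [dirDeriv_add_fun hfs hgs]
    exact ih (hfs.dirDeriv hξ) (hgs.dirDeriv hξ) (hf.2 ξ hξ) (hg.2 ξ hξ)

theorem VanishesToOrder.const_mul {f : N → ℝ} (a : ℝ) (hfs : SmoothFun m f)
    (hf : VanishesToOrder m Q ℓ f) : VanishesToOrder m Q ℓ (fun x => a * f x) := by
  induction ℓ generalizing f with
  | zero => exact vanishesToOrder_zero _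
  | succ ℓ ih =>
    rw [vanishesToOrder_succ_iff] at hf ⊢
    refine ⟨fun u hu => by simp [hf.1 u hu], fun ξ hξ => ?_⟩
    rw [dirDeriv_const_mul a hfs]
    exact ih (hfs.dirDeriv hξ) (hf.2 ξ hξ)

theorem VanishesToOrder.sub {f g : N → ℝ} (hfs : SmoothFun m f) (hgs : SmoothFun m g)
    (hf : VanishesToOrder m Q ℓ f) (hg : VanishesToOrder m Q ℓ g) :
    VanishesToOrder m Q ℓ (f - g) := by
  have h1 : f - g = f + fun x => (-1) * g x := by funext x; simp [sub_eq_add_neg]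
  rw [h1]
  exact hf.add hfs (contMDiff_const.mul hgs) (hg.const_mul (-1) hgs)

/-- Derivatives along fields that annihilate along `Q` all functions vanishing on `Q` preserve the
order of vanishing. -/
theorem VanishesToOrder.dirDeriv_of_tangent [T2Space N] {ζ : VecField m N} (hζ : SmoothField ζ)
    (htan : ∀ f : N → ℝ, SmoothFun m f → (∀ u ∈ Q, f u = 0) → ∀ u ∈ Q, dirDeriv ζ f u = 0)
    {f : N → ℝ} (hfs : SmoothFun m f) (hf : VanishesToOrder m Q ℓ f) :
    VanishesToOrder m Q ℓ (dirDeriv ζ f) := by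
  induction ℓ generalizing f with
  | zero => exact vanishesToOrder_zero _
  | succ ℓ ih =>
    rw [vanishesToOrder_succ_iff] at hf ⊢
    refine ⟨htan f hfs hf.1, fun ξ hξ => ?_⟩
    -- Commuting ξ past ζ leaves [ξ, ζ] · f, which has order ℓ already, and ζ · (ξ · f), covered by
    -- the induction hypothesis for ξ · f.
    have h1 : dirDeriv ξ (dirDeriv ζ f) = dirDeriv (lieBr ξ ζ) f + dirDeriv ζ (dirDeriv ξ f) := by
      funext x
      simp [dirDeriv_lieBr hξ hζ hfs]
    rw [h1]
    exact (hf.2 _ (hξ.lieBr hζ)).add (hfs.dirDeriv (hξ.lieBr hζ))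
      ((hfs.dirDeriv hξ).dirDeriv hζ) (ih (hfs.dirDeriv hξ) (hf.2 ξ hξ))

/-- By induction, since ξ · t(η, ζ) differs from (ℒ_ξ t)(η, ζ) only by components of `t` itself.
Applying the hypothesis to ℒ_ξ t requires `t` to vary. -/
theorem TensorVanishesToOrder.vanishesToOrder {t : VecField m N → VecField m N → N → ℝ}
    (ht : ∀ η ζ, SmoothField η → SmoothField ζ → SmoothFun m (t η ζ))
    (h : TensorVanishesToOrder Q ℓ t) {η ζ : VecField m N} (hη : SmoothField η)
    (hζ : SmoothField ζ) : VanishesToOrder m Q ℓ (t η ζ) := by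
  induction ℓ generalizing t η ζ with
  | zero => exact vanishesToOrder_zero _
  | succ ℓ ih =>
    have hm : TensorVanishesToOrder Q ℓ t := fun L hL => h L (hL.trans (Nat.lt_succ_self ℓ))
    refine vanishesToOrder_succ_iff.2 ⟨h [] (by simp) (by simp) η ζ hη hζ, fun ξ hξ => ?_⟩
    have hlie : TensorVanishesToOrder Q ℓ (lieDerivTwo ξ t) := by
      intro L hL hLs a b ha hb u hu
      have h1 := h (L ++ [ξ]) (by simpa using hL)
        (by simpa [or_imp, forall_and] using ⟨hLs, hξ⟩) a b ha hb u hu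
      simpa using h1
    have hlies : ∀ a b, SmoothField a → SmoothField b → SmoothFun m (lieDerivTwo ξ t a b) :=
      fun a b ha hb => (((ht a b ha hb).dirDeriv hξ).sub (ht _ b (hξ.lieBr ha) hb)).sub
        (ht a _ ha (hξ.lieBr hb))
    have h1 : dirDeriv ξ (t η ζ) = lieDerivTwo ξ t η ζ + (t (lieBr ξ η) ζ + t η (lieBr ξ ζ)) := by
      funext x
      simp only [lieDerivTwo, Pi.add_apply]
      ring
    rw [h1]
    have s1 := ht _ _ (hξ.lieBr hη) hζ
    have s2 := ht _ _ hη (hξ.lieBr hζ)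
    exact (ih hlies hlie hη hζ).add (hlies _ _ hη hζ) (s1.add s2)
      ((ih ht hm (hξ.lieBr hη) hζ).add s1 s2 (ih ht hm hη (hξ.lieBr hζ)))

end Vanishing

/-! ### The generator of the action and fields tangent to 𝒬. -/

section Ambient

variable {n p q : ℕ} {M : Type*} [TopologicalSpace M] [ChartedSpace (EuclideanSpace ℝ (Fin n)) M]
    [IsManifold (𝓡 n) ∞ M] {c : ConformalStructure n p q M} {N : Type*} [TopologicalSpace N]
    [ChartedSpace (EuclideanSpace ℝ (Fin (n + 2))) N] [IsManifold (𝓡 (n + 2)) ∞ N]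
    [MulAction {s : ℝ // 0 < s} N]

/-- X is the tangent map of the action composed with the smooth map x ↦ (∂_t, 0) at (0, x). -/
theorem AmbientManifold.smooth_generator (A : AmbientManifold c N) :
    SmoothField A.generator := by
  let Φ : ℝ × N → N := fun z => (⟨Real.exp z.1, Real.exp_pos z.1⟩ : {s : ℝ // 0 < s}) • z.2
  have hΦ : ContMDiff (𝓘(ℝ, ℝ).prod (𝓡 (n + 2))) (𝓡 (n + 2)) ∞ Φ := A.smooth_action
  have hΦ0 : ∀ x, Φ (0, x) = x := by
    intro x
    have h1 : (⟨Real.exp 0, Real.exp_pos 0⟩ : {s : ℝ // 0 < s}) = 1 := Subtype.ext Real.exp_zero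
    change (⟨Real.exp 0, Real.exp_pos 0⟩ : {s : ℝ // 0 < s}) • x = x
    rw [h1, one_smul]
  have h1 : ContMDiff (𝓘(ℝ, ℝ).prod (𝓡 (n + 2))).tangent (𝓡 (n + 2)).tangent ∞
      (tangentMap (𝓘(ℝ, ℝ).prod (𝓡 (n + 2))) (𝓡 (n + 2)) Φ) :=
    hΦ.contMDiff_tangentMap (by simp)
  have h2 : ContMDiff (𝓡 (n + 2)) (𝓘(ℝ, ℝ).prod (𝓡 (n + 2))).tangent ∞ (fun x : N =>
      (equivTangentBundleProd 𝓘(ℝ, ℝ) ℝ (𝓡 (n + 2)) N).symm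
        ((⟨0, (1 : ℝ)⟩ : TangentBundle 𝓘(ℝ, ℝ) ℝ),
          zeroSection (EuclideanSpace ℝ (Fin (n + 2))) (TangentSpace (𝓡 (n + 2))) x)) :=
    contMDiff_equivTangentBundleProd_symm.comp
      (contMDiff_const.prodMk (contMDiff_zeroSection ℝ (TangentSpace (𝓡 (n + 2)))))
  refine (h1.comp h2).congr fun x => ?_
  -- The derivative is based at Φ(0, x), equal to x only propositionally; the base point is changed
  -- while the model vector is kept.
  have hcast : ∀ (x y : N) (v : EuclideanSpace ℝ (Fin (n + 2))), x = y →
      (⟨x, v⟩ : TangentBundle (𝓡 (n + 2)) N) = ⟨y, v⟩ := by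
    rintro x _ v rfl; rfl
  refine (hcast x (Φ (0, x)) _ (hΦ0 x).symm).trans ?_
  refine congrArg (fun v : EuclideanSpace ℝ (Fin (n + 2)) =>
    (⟨Φ (0, x), v⟩ : TangentBundle (𝓡 (n + 2)) N)) ?_
  have h3 := mfderiv_comp_apply (I := 𝓘(ℝ, ℝ)) (I' := 𝓘(ℝ, ℝ).prod (𝓡 (n + 2)))
    (I'' := 𝓡 (n + 2)) (g := Φ) (f := fun t : ℝ => (t, x)) (0 : ℝ)
    ((hΦ (0, x)).mdifferentiableAt (by simp))
    (mdifferentiableAt_id.prodMk mdifferentiableAt_const) (1 : ℝ)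
  rw [mfderiv_prod_left] at h3
  exact h3

/-- Fields tangent to `𝒬` annihilate along `𝒬` the functions that vanish on `𝒬`. -/
theorem AmbientManifold.IsTangent.dirDeriv_eq_zero {A : AmbientManifold c N}
    {ζ : VecField (n + 2) N} (hζ : A.IsTangent ζ) {f : N → ℝ} (hf : SmoothFun (n + 2) f)
    (h0 : ∀ u ∈ Set.range A.ι, f u = 0) : ∀ u ∈ Set.range A.ι, dirDeriv ζ f u = 0 := by
  rintro _ ⟨u, rfl⟩
  obtain ⟨v, hv⟩ := hζ u
  have hι : MDifferentiableAt (ConformalStructure.rayModel n) (𝓡 (n + 2)) A.ι u :=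
    (A.isSmoothEmbedding.contMDiff u).mdifferentiableAt (by simp)
  have h1 := mvfderiv_comp_apply u (hf.mdiff (A.ι u)) hι v
  have h2 : f ∘ A.ι = fun _ => 0 := funext fun w => h0 _ ⟨w, rfl⟩
  rw [h2, mvfderiv_const, hv] at h1
  exact h1.symm

theorem IsAmbientMetric.isHomothetic {A : AmbientManifold c N} {h : BilinField (n + 2) N}
    (hh : IsAmbientMetric A h) : IsHomothetic h A.generator :=
  ⟨A.smooth_generator, hh.homogeneous⟩

end Ambient

/-! ### Orders of vanishing of ∇t. -/

section CovariantDerivative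

variable {m : ℕ} {N : Type*} [TopologicalSpace N] [ChartedSpace (EuclideanSpace ℝ (Fin m)) N]
    [IsManifold (𝓡 m) ∞ N] [T2Space N] {p q : ℕ} {h : BilinField m N}
    {Q : Set N} {t : VecField m N → VecField m N → N → ℝ}

theorem SmoothFun.covDerivTwo (hh : IsPseudoRiemannian p q h)
    (ht : ∀ η ζ, SmoothField η → SmoothField ζ → SmoothFun m (t η ζ)) {ζ ξ η : VecField m N}
    (hζ : SmoothField ζ) (hξ : SmoothField ξ) (hη : SmoothField η) :
    SmoothFun m (covDerivTwo h t ζ ξ η) :=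
  (((ht _ _ hξ hη).dirDeriv hζ).sub (ht _ _ (hζ.leviCivita hh hξ) hη)).sub
    (ht _ _ hξ (hζ.leviCivita hh hη))

/-- If the components of `t` are `O(r^ℓ)`, then `(∇t)(ζ, ξ, η)` and `ζ · t(ξ, η)` vanish to the
same orders up to `ℓ`. -/
theorem vanishesToOrder_covDerivTwo_iff (hh : IsPseudoRiemannian p q h)
    (ht : ∀ η ζ, SmoothField η → SmoothField ζ → SmoothFun m (t η ζ)) {k : ℕ}
    (hv : ∀ η ζ, SmoothField η → SmoothField ζ → VanishesToOrder m Q k (t η ζ))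
    {ζ ξ η : VecField m N} (hζ : SmoothField ζ) (hξ : SmoothField ξ) (hη : SmoothField η) :
    VanishesToOrder m Q k (covDerivTwo h t ζ ξ η) ↔
      VanishesToOrder m Q k (dirDeriv ζ (t ξ η)) := by
  have s1 := ht _ _ (hζ.leviCivita hh hξ) hη
  have s2 := ht _ _ hξ (hζ.leviCivita hh hη)
  have hsum := (hv _ _ (hζ.leviCivita hh hξ) hη).add s1 s2 (hv _ _ hξ (hζ.leviCivita hh hη))
  constructor
  · intro h1
    have e : dirDeriv ζ (t ξ η) = covDerivTwo h t ζ ξ η +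
        (t (leviCivita h ζ ξ) η + t ξ (leviCivita h ζ η)) := by
      funext x
      simp only [covDerivTwo, Pi.add_apply]
      ring
    rw [e]
    exact h1.add (SmoothFun.covDerivTwo hh ht hζ hξ hη) (s1.add s2) hsum
  · intro h1
    have e : covDerivTwo h t ζ ξ η = dirDeriv ζ (t ξ η) -
        (t (leviCivita h ζ ξ) η + t ξ (leviCivita h ζ η)) := by
      funext x
      simp only [covDerivTwo, Pi.add_apply, Pi.sub_apply]
      ring
    rw [e]
    exact h1.sub ((ht _ _ hξ hη).dirDeriv hζ) (s1.add s2) hsum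

end CovariantDerivative

/-! ### The proposition. -/

theorem proposition2p5 {n p q : ℕ} {M : Type*} [TopologicalSpace M] [T2Space M]
    [SecondCountableTopology M] [ChartedSpace (EuclideanSpace ℝ (Fin n)) M]
    [IsManifold (𝓡 n) ∞ M] {c : ConformalStructure n p q M}
    {N : Type*} [TopologicalSpace N] [T2Space N] [SecondCountableTopology N]
    [ChartedSpace (EuclideanSpace ℝ (Fin (n + 2))) N] [IsManifold (𝓡 (n + 2)) ∞ N]
    [MulAction {s : ℝ // 0 < s} N]
    (A : AmbientManifold c N) (h : BilinField (n + 2) N) (hh : IsAmbientMetric A h) :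
    -- the identities for the ambient curvature
    (∀ ξ η ζ : VecField (n + 2) N, SmoothField ξ → SmoothField η → SmoothField ζ → ∀ x,
      pairing h (riemann h ξ η A.generator) ζ x = -pairing h (riemann h ξ η ζ) A.generator x ∧
      pairing h (riemann h ξ η A.generator) ζ x = pairing h (riemann h A.generator ζ ξ) η x ∧
      pairing h (riemann h ξ η A.generator) ζ x =
        -(1 / 2) * covDerivTwo h (extDerivOne (A.dualForm h)) ζ ξ η x) ∧
    -- the consequences of `dα = O(r^ℓ)`
    (∀ ℓ : ℕ, 1 ≤ ℓ →
      TensorVanishesToOrder (Set.range A.ι) ℓ (extDerivOne (A.dualForm h)) →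
        (∀ ξ η ζ : VecField (n + 2) N, SmoothField ξ → SmoothField η → SmoothField ζ →
          VanishesToOrder (n + 2) (Set.range A.ι) (ℓ - 1)
            (pairing h (riemann h ξ η A.generator) ζ)) ∧
        (∀ ξ η ζ : VecField (n + 2) N, SmoothField ξ → SmoothField η → SmoothField ζ →
          A.IsTangent ζ ∨ (A.IsTangent ξ ∧ A.IsTangent η) →
          VanishesToOrder (n + 2) (Set.range A.ι) ℓ (pairing h (riemann h ξ η A.generator) ζ)) ∧
        A.TangentialVanishesToOrder (ℓ + 1) (extDerivOne (A.dualForm h))) := by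
  have hX := hh.isHomothetic
  have hP := hh.isPseudoRiemannian
  refine ⟨fun ξ η ζ hξ hη hζ x => ⟨pairing_riemann_swap hP hξ hη hX.smooth hζ x,
    pairing_riemann_pair_symm hP hξ hη hX.smooth hζ x, hX.pairing_riemann_eq hP hξ hη hζ x⟩, ?_⟩
  intro ℓ hℓ hdα
  -- `extDerivDual h A.generator` unfolds to the same two-form as `extDerivOne (A.dualForm h)`.
  have hs : ∀ η ζ, SmoothField η → SmoothField ζ →
      SmoothFun (n + 2) (extDerivDual h A.generator η ζ) :=
    fun η ζ hη hζ => hX.smooth_extDeriv hP hη hζ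
  have hv : ∀ η ζ, SmoothField η → SmoothField ζ → VanishesToOrder (n + 2) (Set.range A.ι) ℓ
      (extDerivDual h A.generator η ζ) :=
    fun η ζ hη hζ => TensorVanishesToOrder.vanishesToOrder hs hdα hη hζ
  have hR : ∀ {k : ℕ} {ξ η ζ : VecField (n + 2) N}, SmoothField ξ → SmoothField η →
      SmoothField ζ → VanishesToOrder (n + 2) (Set.range A.ι) k
        (covDerivTwo h (extDerivDual h A.generator) ζ ξ η) →
      VanishesToOrder (n + 2) (Set.range A.ι) k (pairing h (riemann h ξ η A.generator) ζ) := by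
    intro k ξ η ζ hξ hη hζ h1
    rw [funext (hX.pairing_riemann_eq hP hξ hη hζ)]
    exact h1.const_mul _ (SmoothFun.covDerivTwo hP hs hζ hξ hη)
  have htan : ∀ {ζ ξ η : VecField (n + 2) N}, SmoothField ζ → SmoothField ξ → SmoothField η →
      A.IsTangent ζ → VanishesToOrder (n + 2) (Set.range A.ι) ℓ
        (covDerivTwo h (extDerivDual h A.generator) ζ ξ η) := by
    intro ζ ξ η hζ hξ hη hT
    exact (vanishesToOrder_covDerivTwo_iff hP hs hv hζ hξ hη).2
      ((hv ξ η hξ hη).dirDeriv_of_tangent hζ (fun _ hf => hT.dirDeriv_eq_zero hf) (hs ξ η hξ hη))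
  have htan₂ : ∀ {ζ ξ η : VecField (n + 2) N}, SmoothField ζ → SmoothField ξ → SmoothField η →
      A.IsTangent ξ → A.IsTangent η → VanishesToOrder (n + 2) (Set.range A.ι) ℓ
        (covDerivTwo h (extDerivDual h A.generator) ζ ξ η) := by
    intro ζ ξ η hζ hξ hη hTξ hTη
    have s1 := SmoothFun.covDerivTwo hP hs hξ hη hζ
    have s2 := SmoothFun.covDerivTwo hP hs hη hζ hξ
    -- The cyclic identity replaces the derivative along the arbitrary ζ by derivatives along the
    -- tangent fields ξ and η.
    have e : covDerivTwo h (extDerivDual h A.generator) ζ ξ η = fun x => (-1) *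
        (covDerivTwo h (extDerivDual h A.generator) ξ η ζ +
          covDerivTwo h (extDerivDual h A.generator) η ζ ξ) x := by
      funext x
      have h1 := hX.covDeriv_cyclic hP hξ hη hζ x
      simp only [Pi.add_apply]
      linarith
    rw [e]
    exact ((htan hξ hη hζ hTξ).add s1 s2 (htan hη hζ hξ hTη)).const_mul _ (s1.add s2)
  obtain ⟨k, rfl⟩ : ∃ k, ℓ = k + 1 := ⟨ℓ - 1, by omega⟩
  refine ⟨fun ξ η ζ hξ hη hζ => hR hξ hη hζ ?_, fun ξ η ζ hξ hη hζ hT => hR hξ hη hζ ?_, ?_⟩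
  -- With ℓ = k + 1, a derivative along an arbitrary ζ leaves order k.
  · exact (vanishesToOrder_covDerivTwo_iff hP hs
      (fun a b ha hb => (hv a b ha hb).mono k.le_succ) hζ hξ hη).2
      ((vanishesToOrder_succ_iff.1 (hv ξ η hξ hη)).2 ζ hζ)
  · rcases hT with hT | ⟨hTξ, hTη⟩
    · exact htan hζ hξ hη hT
    · exact htan₂ hζ hξ hη hTξ hTη
  · intro ξ η hξ hη hTξ hTη
    -- Order ℓ + 1 means: zero on 𝒬, which holds as ℓ ≥ 1, and all first derivatives O(r^ℓ), which
    -- `htan₂` supplies.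
    refine vanishesToOrder_succ_iff.2 ⟨(vanishesToOrder_succ_iff.1 (hv ξ η hξ hη)).1,
      fun ζ hζ => ?_⟩
    exact (vanishesToOrder_covDerivTwo_iff hP hs hv hζ hξ hη).1 (htan₂ hζ hξ hη hTξ hTη)
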